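/- Let $N\ge 2$, $\sigma>0$, $\delta>0$. On a probability space let $B=(B_1,\dots,B_N)$ be a standard $N$-dimensional Brownian motion, $0=\tau_0<\tau_1<\tau_2<\cdots$ the epochs of a Poisson flow of intensity $\delta$ (the $\tau_n-\tau_{n-1}$ are independent and exponential with parameter $\delta$), $x(0)\in\mathbb R^N$ a random initial configuration, and $(i_1,j_1),(i_2,j_2),\dots$ a sequence of independent, equiprobable ordered pairs of distinct elements of $\{1,\dots,N\}$; these four objects are independent. Let $x(t)=(x_1(t),\dots,x_N(t))$, $t\ge0$, be the right-continuous process with $x_k(s)-x_k(\tau_n)=\sigma\,(B_k(s)-B_k(\tau_n))$ for $s\in[\tau_n,\tau_{n+1})$ and all $k$, $n\ge 0$, and, for $n\ge1$, $x_{j_n}(\tau_n)=x_{i_n}(\tau_n-0)$ and $x_m(\tau_n)=x_m(\tau_n-0)$ for $m\ne j_n$. Put $M(x)=\frac1N\sum_{m=1}^N x_m$ and $x^\circ_i(t)=x_i(t)-M(x(t))$. Then $x^\circ(t)$ is an ergodic Markov process. Precisely, there are a time-homogeneous transition function $(P_t)_{t\ge0}$ on $\{y\in\mathbb R^N: M(y)=0\}$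 and a probability measure $\mu^N$ on $(\mathbb R^N,\mathcal B(\mathbb R^N))$ carried by this hyperplane, both depending only on $N,\sigma,\delta$, such that 1. for every choice of the probability space and of the objects above, in particular for every law of $x(0)$, $x^\circ$ is a Markov process with transition function $(P_t)$; 2. $(P_t)$ satisfies Doeblin's condition: there are $t_0>0$, $\varepsilon>0$ and a probability measure $\nu$ with $P_{t_0}(y,\cdot)\ge\varepsilon\,\nu$ for all $y$; 3. $\mu^N$ is the unique invariant probability measure of $(P_t)$, and $P_t(y,\cdot)\to\mu^N$ in total variation as $t\to\infty$ for every $y$; 4. for every such process, $\mathcal L(x^\circ(t))\to\mu^N$ in total variation (hence weakly) as $t\to\infty$. -/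

import Mathlib

open MeasureTheory ProbabilityTheory Filter Topology
open scoped NNReal ENNReal

/-- The center of mass `M(x) = (1/N) ∑ x_m` of a configuration of `N` particles on the line. -/
noncomputable def centerOfMass {N : ℕ} (x : Fin N → ℝ) : ℝ := (∑ m, x m) / (N : ℝ)

/-- The configurations whose center of mass is at the origin: the state space of the particle
system seen from its center of mass. -/
abbrev CenteredConfig (N : ℕ) : Type := {y : Fin N → ℝ // centerOfMass y = 0}

theorem centerOfMass_sub_self {N : ℕ} (x : Fin N → ℝ) :
    centerOfMass (fun i => x i - centerOfMass x) = 0 := by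
  rcases Nat.eq_zero_or_pos N with h | h
  · subst h
    simp [centerOfMass]
  · have hN : (N : ℝ) ≠ 0 := by exact_mod_cast h.ne'
    simp only [centerOfMass, Finset.sum_sub_distrib, Finset.sum_const, Finset.card_univ,
      Fintype.card_fin, nsmul_eq_mul]
    field_simp
    simp

/-- The configuration `x° = (x_i - M(x))_i` viewed from the center of mass of `x`. -/
noncomputable def fromCenter {N : ℕ} (x : Fin N → ℝ) : CenteredConfig N :=
  ⟨fun i => x i - centerOfMass x, centerOfMass_sub_self x⟩

/-- A standard `N`-dimensional Brownian motion: the coordinates are independent standard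
one-dimensional Brownian motions (started from `0`, with almost surely continuous paths). -/
structure IsStandardBrownian {N : ℕ} {Ω : Type*} [MeasurableSpace Ω]
    (B : ℝ≥0 → Ω → Fin N → ℝ) (P : Measure Ω) : Prop where
  measurable : ∀ t, Measurable (B t)
  coord : ∀ k, IsBrownianReal (fun t ω => B t ω k) P
  indep : iIndepFun (fun k ω (t : ℝ≥0) => B t ω k) P

/-- `0 = τ 0 < τ 1 < τ 2 < ⋯` are the epochs of a Poisson flow of intensity `δ`: the waiting times
`τ (n + 1) - τ n` are independent and exponentially distributed with parameter `δ`. -/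
structure IsPoissonFlow {Ω : Type*} [MeasurableSpace Ω] (δ : ℝ)
    (τ : ℕ → Ω → ℝ≥0) (P : Measure Ω) : Prop where
  measurable : ∀ n, Measurable (τ n)
  zero : ∀ᵐ ω ∂P, τ 0 ω = 0
  strictMono : ∀ᵐ ω ∂P, StrictMono fun n => τ n ω
  law : ∀ n, HasLaw (fun ω => (τ (n + 1) ω : ℝ) - (τ n ω : ℝ)) (expMeasure δ) P
  indep : iIndepFun (fun n ω => (τ (n + 1) ω : ℝ) - (τ n ω : ℝ)) P

/-- A sequence of independent, equiprobable ordered pairs `(i, j)` with `i ≠ j`. -/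
structure IsUniformPairs {N : ℕ} {Ω : Type*} [MeasurableSpace Ω]
    (q : ℕ → Ω → Fin N × Fin N) (P : Measure Ω) : Prop where
  measurable : ∀ n, Measurable (q n)
  law : ∀ n, HasLaw (q n) (uniformOn {p : Fin N × Fin N | p.1 ≠ p.2}) P
  indep : iIndepFun q P

/-- `x` is the system of `N` Brownian particles with diffusion coefficient `σ` and pairwise
synchronization at the epochs of a Poisson flow of intensity `δ`, driven by `B`, `τ` and `q`.
The pair used at the epoch `τ (n + 1)` is `q n = (i, j)`: particle `j` jumps to particle `i`.
The values at the left limit `τ (n + 1) - 0` are expressed through limits along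
`𝓝[<] (τ (n + 1))`. The initial configuration `x 0` is arbitrary. -/
structure IsSynchronizedSystem {N : ℕ} {Ω : Type*} [MeasurableSpace Ω] (σ δ : ℝ)
    (B : ℝ≥0 → Ω → Fin N → ℝ) (τ : ℕ → Ω → ℝ≥0) (q : ℕ → Ω → Fin N × Fin N)
    (x : ℝ≥0 → Ω → Fin N → ℝ) (P : Measure Ω) : Prop where
  brownian : IsStandardBrownian B P
  poisson : IsPoissonFlow δ τ P
  pairs : IsUniformPairs q P
  measurable : ∀ t, Measurable (x t)
  /-- The Brownian motion, the epochs, the initial configuration and the sequence of pairs are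
  mutually independent. -/
  indep : iIndep ![MeasurableSpace.comap (fun ω t => B t ω) inferInstance,
    MeasurableSpace.comap (fun ω n => τ n ω) inferInstance,
    MeasurableSpace.comap (x 0) inferInstance,
    MeasurableSpace.comap (fun ω n => q n ω) inferInstance] P
  rightCont : ∀ᵐ ω ∂P, ∀ t, ContinuousWithinAt (fun s => x s ω) (Set.Ici t) t
  free : ∀ᵐ ω ∂P, ∀ n, ∀ s ∈ Set.Ico (τ n ω) (τ (n + 1) ω), ∀ k,
    x s ω k - x (τ n ω) ω k = σ * (B s ω k - B (τ n ω) ω k)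
  jump : ∀ᵐ ω ∂P, ∀ n, Tendsto (fun s => x s ω (q n ω).1) (𝓝[<] (τ (n + 1) ω))
    (𝓝 (x (τ (n + 1) ω) ω (q n ω).2))
  stay : ∀ᵐ ω ∂P, ∀ n, ∀ m, m ≠ (q n ω).2 →
    Tendsto (fun s => x s ω m) (𝓝[<] (τ (n + 1) ω)) (𝓝 (x (τ (n + 1) ω) ω m))

/-- A time-homogeneous transition function (semigroup of Markov kernels) in continuous time. -/
structure IsTransitionFunction {E : Type*} [MeasurableSpace E] (κ : ℝ≥0 → Kernel E E) : Prop where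
  markov : ∀ t, IsMarkovKernel (κ t)
  zero : κ 0 = Kernel.id
  add : ∀ s t, κ (s + t) = κ t ∘ₖ κ s

/-- The σ-algebra generated by the process `X` up to time `s`. -/
@[reducible]
def history {E Ω : Type*} [MeasurableSpace E] (X : ℝ≥0 → Ω → E) (s : ℝ≥0) : MeasurableSpace Ω :=
  ⨆ r ∈ Set.Iic s, MeasurableSpace.comap (X r) inferInstance

/-- `X` is a Markov process (with respect to its own history) with transition function `κ`:
`P(X (s + t) ∈ A | X r, r ≤ s) = κ t (X s) A` almost surely. -/
structure IsMarkovProcess {E Ω : Type*} [MeasurableSpace E] [MeasurableSpace Ω]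
    (X : ℝ≥0 → Ω → E) (κ : ℝ≥0 → Kernel E E) (P : Measure Ω) : Prop where
  measurable : ∀ t, Measurable (X t)
  markov : ∀ s t : ℝ≥0, ∀ A : Set E, MeasurableSet A →
    P⟦X (s + t) ⁻¹' A | history X s⟧ =ᵐ[P] fun ω => (κ t (X s ω)).real A

/-- Convergence in total variation as time tends to infinity:
`sup_A |ν t A - π A| → 0`, the supremum being over all measurable sets `A`. -/
def TendstoInTotalVariation {E : Type*} [MeasurableSpace E] (ν : ℝ≥0 → Measure E)
    (π : Measure E) : Prop :=
  TendstoUniformlyOn (fun t A => (ν t).real A) (fun A => π.real A) atTop {A | MeasurableSet A}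

/-- The transition function `κ` is ergodic with limiting distribution `π`: `π` is its unique
invariant probability measure, and from every starting point the law at time `t` converges to `π`
in total variation. -/
structure IsErgodicWith {E : Type*} [MeasurableSpace E] (κ : ℝ≥0 → Kernel E E)
    (π : Measure E) : Prop where
  isProbabilityMeasure : IsProbabilityMeasure π
  invariant : ∀ t, Kernel.Invariant (κ t) π
  unique : ∀ π' : Measure E, IsProbabilityMeasure π' →
    (∀ t, Kernel.Invariant (κ t) π') → π' = π
  tendsto : ∀ y, TendstoInTotalVariation (fun t => κ t y) π

/-- Doeblin's condition: at some positive time the transition probabilities from all states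
dominate a common nonzero measure. -/
def SatisfiesDoeblin {E : Type*} [MeasurableSpace E] (κ : ℝ≥0 → Kernel E E) : Prop :=
  ∃ t : ℝ≥0, 0 < t ∧ ∃ ε : ℝ≥0, 0 < ε ∧ ∃ ν : Measure E, IsProbabilityMeasure ν ∧
    ∀ y, ∀ A, MeasurableSet A → (ε : ℝ≥0∞) * ν A ≤ κ t y A

/-! ### Doeblin's theorem for continuous-time transition functions. -/

section Doeblin

/-! Brownian displacements and jumps of one particle onto another commute with translations, so the
differences `x_i - x_j` evolve autonomously. The centred system therefore follows a Gaussian flow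
between epochs and applies `centeredSynchronize` at each epoch, driven by i.i.d. marks (an
exponential waiting time and a uniform pair). Exponential waiting times are memoryless, so the marks
seen after a fixed time are a fresh copy, independent of the past (`lintegral_shiftMarks`). This
gives both the semigroup property (`isTransitionFunction_jumpTransition`) and, later, the Markov
property.

Ergodicity comes from a collapse. With positive probability exactly `N - 1` jumps occur up to time
1, and in them the other particles land one after another on the first one. Each such jump erases
the earlier position of the jumping particle relative to the first, so on this event the law at time
1 does not depend on the start (`lintegral_markedFlow_eq_of_forget`). This is Doeblin's condition.
It contracts oscillations by a factor `1 - ε` per step, whence an invariant law, its uniqueness, and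
convergence in total variation from every initial law (`SatisfiesDoeblin.exists_isErgodicWith`).

A given system is almost surely a measurable functional `pathFlow` of its marks, its Brownian path
and `x 0` (`IsSynchronizedSystem.ae_eq_pathFlow`), and the marks are independent of the other two.
For frozen marks the jump times are deterministic, and independence of Brownian increments gives the
Markov property one jump at a time (`IsBrownianPathLaw.lintegral_pathFlowAux`). Averaging over the
marks, with the future ones replaced by a fresh copy, produces `centeredTransition`. -/

variable {E : Type*} [MeasurableSpace E]

/-- The bounds of `g` contract under averaging against measures that dominate `ε • ν`. -/
theorem integral_mem_Icc_of_minorization {m ν : Measure E} [IsProbabilityMeasure m]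
    [IsProbabilityMeasure ν] {ε : ℝ≥0} (hle : ε • ν ≤ m) {g : E → ℝ} (hg : Measurable g)
    {a b : ℝ} (hab : ∀ y, g y ∈ Set.Icc a b) :
    ∫ y, g y ∂m ∈ Set.Icc (ε * ∫ y, g y ∂ν + (1 - ε) * a) (ε * ∫ y, g y ∂ν + (1 - ε) * b) := by
  have hint : ∀ (l : Measure E) [IsFiniteMeasure l], Integrable g l := fun l _ =>
    Integrable.of_mem_Icc a b hg.aemeasurable (ae_of_all _ hab)
  have h1 : ∫ y, (g y - a) ∂(ε • ν) ≤ ∫ y, (g y - a) ∂m :=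
    integral_mono_measure hle (ae_of_all _ fun y => sub_nonneg.2 (hab y).1)
      ((hint m).sub (integrable_const a))
  have h2 : ∫ y, (b - g y) ∂(ε • ν) ≤ ∫ y, (b - g y) ∂m :=
    integral_mono_measure hle (ae_of_all _ fun y => sub_nonneg.2 (hab y).2)
      ((integrable_const b).sub (hint m))
  rw [integral_smul_nnreal_measure, integral_sub (hint _) (integrable_const _),
    integral_sub (hint _) (integrable_const _)] at h1
  rw [integral_smul_nnreal_measure, integral_sub (integrable_const _) (hint _),
    integral_sub (integrable_const _) (hint _)] at h2
  simp only [integral_const, probReal_univ, smul_eq_mul, one_mul, NNReal.smul_def] at h1 h2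
  constructor <;> nlinarith

variable {κ : ℝ≥0 → Kernel E E}

theorem IsTransitionFunction.integral_add (h : IsTransitionFunction κ) (s t : ℝ≥0) {g : E → ℝ}
    (hg : Measurable g) {a b : ℝ} (hab : ∀ y, g y ∈ Set.Icc a b) (y : E) :
    ∫ z, g z ∂κ (s + t) y = ∫ w, ∫ z, g z ∂κ t w ∂κ s y := by
  have := h.markov
  rw [h.add, Kernel.integral_comp]
  exact Integrable.of_mem_Icc a b hg.aemeasurable (ae_of_all _ hab)

theorem integral_mem_Icc (m : Measure E) [IsProbabilityMeasure m] {g : E → ℝ} (hg : Measurable g)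
    {a b : ℝ} (hab : ∀ y, g y ∈ Set.Icc a b) : ∫ z, g z ∂m ∈ Set.Icc a b := by
  have hint : Integrable g m := Integrable.of_mem_Icc a b hg.aemeasurable (ae_of_all _ hab)
  constructor
  · simpa using integral_mono (integrable_const a) hint fun y => (hab y).1
  · simpa using integral_mono hint (integrable_const b) fun y => (hab y).2

/-- One more step of length `t₀` averages the previous function of `y` against measures sharing the
part `ε • ν`, so its range shrinks by the factor `1 - ε`. The remainder `r` plays no role, which
later covers all real times. -/
theorem IsTransitionFunction.exists_Icc_of_minorization (h : IsTransitionFunction κ) {t₀ : ℝ≥0}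
    {ε : ℝ≥0} {ν : Measure E} [IsProbabilityMeasure ν] (hle : ∀ y, ε • ν ≤ κ t₀ y) (n : ℕ) (r : ℝ≥0)
    {A : Set E} (hA : MeasurableSet A) :
    ∃ a b : ℝ, b - a = (1 - ε : ℝ) ^ n ∧ ∀ y, (κ (n * t₀ + r) y).real A ∈ Set.Icc a b := by
  have := h.markov
  have hind : Measurable (A.indicator (fun _ => (1 : ℝ))) := measurable_const.indicator hA
  induction n with
  | zero =>
    refine ⟨0, 1, by simp, fun y => ?_⟩
    exact ⟨measureReal_nonneg, measureReal_le_one⟩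
  | succ n ih =>
    obtain ⟨a, b, hab, hmem⟩ := ih
    have hm : Measurable fun y => (κ (n * t₀ + r) y).real A :=
      ((κ (n * t₀ + r)).measurable_coe hA).ennreal_toReal
    refine ⟨ε * ∫ y, (κ (n * t₀ + r) y).real A ∂ν + (1 - ε) * a,
      ε * ∫ y, (κ (n * t₀ + r) y).real A ∂ν + (1 - ε) * b, ?_, fun y => ?_⟩
    · rw [pow_succ, ← hab]; ring
    have e : ((n + 1 : ℕ) : ℝ≥0) * t₀ + r = t₀ + (n * t₀ + r) := by push_cast; ring
    have := h.integral_add t₀ (n * t₀ + r) hind (a := 0) (b := 1)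
      (fun y => by by_cases hy : y ∈ A <;> simp [hy]) y
    simp only [integral_indicator_const _ hA, smul_eq_mul, mul_one] at this
    rw [e, this]
    exact integral_mem_Icc_of_minorization (hle y) hm hmem

theorem IsTransitionFunction.abs_sub_le_of_minorization (h : IsTransitionFunction κ) {t₀ : ℝ≥0}
    {ε : ℝ≥0} {ν : Measure E} [IsProbabilityMeasure ν] (hle : ∀ y, ε • ν ≤ κ t₀ y) (n : ℕ) (r : ℝ≥0)
    {A : Set E} (hA : MeasurableSet A) (m m' : Measure E) [IsProbabilityMeasure m]
    [IsProbabilityMeasure m'] :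
    |(m.bind (κ (n * t₀ + r))).real A - (m'.bind (κ (n * t₀ + r))).real A| ≤ (1 - ε : ℝ) ^ n := by
  have := h.markov
  obtain ⟨a, b, hab, hmem⟩ := h.exists_Icc_of_minorization hle n r hA
  have hm : Measurable fun y => (κ (n * t₀ + r) y).real A :=
    ((κ (n * t₀ + r)).measurable_coe hA).ennreal_toReal
  have key : ∀ (m : Measure E) [IsProbabilityMeasure m],
      (m.bind (κ (n * t₀ + r))).real A = ∫ y, (κ (n * t₀ + r) y).real A ∂m := by
    intro m _
    rw [measureReal_def, Measure.bind_apply hA (Kernel.aemeasurable _)]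
    simp only [measureReal_def]
    rw [integral_toReal ((κ _).measurable_coe hA).aemeasurable
      (ae_of_all _ fun y => measure_lt_top _ _)]
  rw [key, key, ← hab]
  have h1 := integral_mem_Icc m hm hmem
  have h2 := integral_mem_Icc m' hm hmem
  rw [abs_le]
  constructor <;> linarith [h1.1, h1.2, h2.1, h2.2]

/-- Regeneration: write `K = ε ν + R` with `R` of constant mass `1 - ε`. Then `∑ ε ν Rⁿ` is a
probability measure by the geometric series, and applying `K` shifts the sum while restoring its
first term. No topology on `E` is needed. -/
theorem exists_invariant_of_minorization (K : Kernel E E) [IsMarkovKernel K] {ε : ℝ≥0} (hε : 0 < ε)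
    {ν : Measure E} [IsProbabilityMeasure ν] (hle : ∀ y, ε • ν ≤ K y) [Nonempty E] :
    ∃ π : Measure E, IsProbabilityMeasure π ∧ π.bind K = π := by
  have hε1 : (ε : ℝ≥0∞) ≤ 1 := by
    have := hle (Classical.arbitrary E) Set.univ
    simpa [Measure.coe_nnreal_smul_apply] using this
  have hmeas : Measurable fun y => K y - ε • ν := by
    refine Measure.measurable_of_measurable_coe _ fun s hs => ?_
    simp_rw [fun y => Measure.sub_apply hs (hle y)]
    exact (K.measurable_coe hs).sub measurable_const
  let R : Kernel E E := ⟨fun y => K y - ε • ν, hmeas⟩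
  have hR : ∀ y, K y = R y + ε • ν := fun y => (Measure.sub_add_cancel_of_le (hle y)).symm
  have hRu : ∀ y, R y Set.univ = 1 - ε := fun y => by
    change (K y - ε • ν) Set.univ = _
    rw [Measure.sub_apply .univ (hle y)]
    simp
  let ρ : ℕ → Measure E := fun n => Nat.rec ν (fun _ m => m.bind R) n
  have hρ : ∀ n, ρ (n + 1) = (ρ n).bind R := fun n => rfl
  have hρu : ∀ n, ρ n Set.univ = (1 - ε : ℝ≥0∞) ^ n := by
    intro n
    induction n with
    | zero => exact measure_univ (μ := ν)
    | succ n ih =>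
      rw [hρ, Measure.bind_apply .univ (Kernel.aemeasurable _)]
      simp [hRu, ih, pow_succ, mul_comm]
  have hsum : ∑' n, (ε : ℝ≥0∞) * (1 - ε) ^ n = 1 := by
    rw [ENNReal.tsum_mul_left, ENNReal.tsum_geometric, ENNReal.sub_sub_cancel ENNReal.one_ne_top hε1]
    exact ENNReal.mul_inv_cancel (by simpa using hε.ne') ENNReal.coe_ne_top
  have hstep : ∀ n, (ρ n).bind K = ρ (n + 1) + ((1 - ε : ℝ≥0∞) ^ n) • (ε • ν) := by
    intro n
    ext s hs
    rw [Measure.bind_apply hs (Kernel.aemeasurable _), Measure.add_apply, hρ,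
      Measure.bind_apply hs (Kernel.aemeasurable _)]
    simp_rw [hR, Measure.add_apply]
    rw [lintegral_add_left (R.measurable_coe hs), lintegral_const, hρu, Measure.smul_apply _ (ε • ν),
      smul_eq_mul, mul_comm]
  refine ⟨Measure.sum fun n => (ε : ℝ≥0∞) • ρ n, ⟨?_⟩, ?_⟩
  · rw [Measure.sum_apply _ .univ, ← hsum]
    simp only [Measure.smul_apply, hρu, smul_eq_mul]
  · ext s hs
    -- The term `n = 0` on the right, `ε ν`, is matched by the total regenerated mass on the left.
    rw [Measure.bind_apply hs (Kernel.aemeasurable _), lintegral_sum_measure, Measure.sum_apply _ hs,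
      tsum_eq_zero_add' (f := fun i => ((ε : ℝ≥0∞) • ρ i) s) ENNReal.summable]
    have : ∀ n, ∫⁻ a, K a s ∂((ε : ℝ≥0∞) • ρ n)
        = ((ε : ℝ≥0∞) • ρ (n + 1)) s + ε * (1 - ε) ^ n * (ε * ν s) := by
      intro n
      rw [lintegral_smul_measure, ← Measure.bind_apply hs (Kernel.aemeasurable _), hstep]
      simp [mul_add, mul_assoc]
    simp_rw [this]
    rw [ENNReal.tsum_add, ENNReal.tsum_mul_right, hsum, one_mul, add_comm]
    rfl

theorem tendsto_one_sub_pow_floor {ε : ℝ} (h0 : 0 < ε) (h1 : ε ≤ 1) {t₀ : ℝ≥0} (ht : 0 < t₀) :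
    Tendsto (fun t : ℝ≥0 => (1 - ε) ^ ⌊t / t₀⌋₊) atTop (𝓝 0) := by
  refine (tendsto_pow_atTop_nhds_zero_of_lt_one (by linarith) (by linarith)).comp ?_
  exact tendsto_nat_floor_atTop.comp (tendsto_id.atTop_div_const ht)

variable [Nonempty E]

/-- Doeblin's theorem: a transition function that satisfies Doeblin's condition is ergodic, and
the convergence to the limiting distribution holds from every initial law. -/
theorem SatisfiesDoeblin.exists_isErgodicWith (hD : SatisfiesDoeblin κ)
    (h : IsTransitionFunction κ) :
    ∃ π : Measure E, IsErgodicWith κ π ∧ ∀ m : Measure E, IsProbabilityMeasure m →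
      TendstoInTotalVariation (fun t => m.bind (κ t)) π := by
  obtain ⟨t₀, ht₀, ε, hε, ν, hν, hmin⟩ := hD
  have hle : ∀ y, ε • ν ≤ κ t₀ y := fun y => Measure.le_iff.2 fun A hA => by
    simpa [Measure.coe_nnreal_smul_apply] using hmin y A hA
  have hM := h.markov
  have hε1 : (ε : ℝ) ≤ 1 := by
    have := hle (Classical.arbitrary E) Set.univ
    simpa [Measure.coe_nnreal_smul_apply] using this
  obtain ⟨π, hπ, hinv⟩ := exists_invariant_of_minorization (κ t₀) hε hle
  have huniq : ∀ π₁ π₂ : Measure E, IsProbabilityMeasure π₁ → IsProbabilityMeasure π₂ →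
      π₁.bind (κ t₀) = π₁ → π₂.bind (κ t₀) = π₂ → π₁ = π₂ := by
    intro π₁ π₂ _ _ h₁ h₂
    have hpow : ∀ m : Measure E, m.bind (κ t₀) = m → ∀ n : ℕ, m.bind (κ (n * t₀ + 0)) = m := by
      intro m hm n
      induction n with
      | zero => simp [h.zero]
      | succ n ih =>
        have e : ((n + 1 : ℕ) : ℝ≥0) * t₀ + 0 = t₀ + (n * t₀ + 0) := by push_cast; ring
        rw [e, h.add, ← Measure.comp_assoc, hm, ih]
    ext A hA
    rw [← ENNReal.toReal_eq_toReal_iff' (measure_ne_top _ _) (measure_ne_top _ _)]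
    have hle' : ∀ n : ℕ, |π₁.real A - π₂.real A| ≤ (1 - ε : ℝ) ^ n := fun n => by
      simpa only [hpow _ h₁, hpow _ h₂] using h.abs_sub_le_of_minorization hle n 0 hA π₁ π₂
    have hlim := ge_of_tendsto' (tendsto_pow_atTop_nhds_zero_of_lt_one (r := (1 - ε : ℝ))
      (by linarith) (by linarith [(NNReal.coe_pos.2 hε)])) hle'
    exact sub_eq_zero.1 (abs_nonpos_iff.1 hlim)
  -- `κ t` commutes with `κ t₀`, so `π κ_t` is again invariant under `κ t₀`, and uniqueness at the
  -- single time `t₀` identifies it with `π`.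
  have hinvt : ∀ t, π.bind (κ t) = π := fun t => by
    refine huniq _ _ inferInstance hπ ?_ hinv
    rw [Measure.comp_assoc, ← h.add, add_comm, h.add, ← Measure.comp_assoc, hinv]
  have hconv : ∀ m : Measure E, IsProbabilityMeasure m →
      TendstoInTotalVariation (fun t => m.bind (κ t)) π := by
    intro m _
    rw [TendstoInTotalVariation, Metric.tendstoUniformlyOn_iff]
    intro η hη
    filter_upwards [(tendsto_one_sub_pow_floor (NNReal.coe_pos.2 hε) hε1 ht₀).eventually_lt_const hη]
      with t ht A hA
    refine lt_of_le_of_lt ?_ ht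
    have e : (⌊t / t₀⌋₊ : ℝ≥0) * t₀ + (t - ⌊t / t₀⌋₊ * t₀) = t :=
      add_tsub_cancel_of_le ((le_div_iff₀ ht₀).1 (Nat.floor_le zero_le))
    have := h.abs_sub_le_of_minorization hle ⌊t / t₀⌋₊ (t - ⌊t / t₀⌋₊ * t₀) hA π m
    rwa [e, hinvt] at this
  refine ⟨π, ⟨hπ, hinvt, fun π' hπ' h' => huniq _ _ hπ' hπ (h' t₀) hinv, fun y => ?_⟩, hconv⟩
  simpa [Measure.dirac_bind (Kernel.measurable _)] using hconv (Measure.dirac y) inferInstance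

end Doeblin

/-! ### Sequences of i.i.d. marks and their shift at a fixed time. -/

section MarkedJumps

/-- Prepend a term to a sequence. -/
def seqCons {M : Type*} (m : M) (θ : ℕ → M) : ℕ → M
  | 0 => m
  | n + 1 => θ n

@[simp] theorem seqCons_zero {M : Type*} (m : M) (θ : ℕ → M) : seqCons m θ 0 = m := rfl

@[simp] theorem seqCons_succ {M : Type*} (m : M) (θ : ℕ → M) (n : ℕ) :
    seqCons m θ (n + 1) = θ n := rfl

/-- Drop the first term of a sequence. -/
def seqTail {M : Type*} (θ : ℕ → M) : ℕ → M := fun n => θ (n + 1)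

@[simp] theorem seqTail_apply {M : Type*} (θ : ℕ → M) (n : ℕ) : seqTail θ n = θ (n + 1) := rfl

@[simp] theorem seqTail_seqCons {M : Type*} (m : M) (θ : ℕ → M) : seqTail (seqCons m θ) = θ := rfl

@[fun_prop]
theorem measurable_seqTail {M : Type*} [MeasurableSpace M] :
    Measurable (seqTail : (ℕ → M) → ℕ → M) :=
  measurable_pi_lambda _ fun n => measurable_pi_apply (n + 1)

@[fun_prop]
theorem measurable_seqCons {M : Type*} [MeasurableSpace M] :
    Measurable fun p : M × (ℕ → M) => seqCons p.1 p.2 := by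
  refine measurable_pi_lambda _ fun n => ?_
  cases n with
  | zero => exact measurable_fst
  | succ n => exact (measurable_pi_apply n).comp measurable_snd

/-- Splits off the first mark, which is what makes inductions on the number of jumps possible. -/
theorem map_seqCons_infinitePi {M : Type*} [MeasurableSpace M] (ρ : Measure M)
    [IsProbabilityMeasure ρ] :
    (ρ.prod (Measure.infinitePi fun _ : ℕ => ρ)).map (fun p => seqCons p.1 p.2) =
      Measure.infinitePi fun _ : ℕ => ρ := by
  refine Measure.eq_infinitePi _ fun s t ht => ?_
  -- Filling up with `univ` turns the box over `s` into one over an initial segment, where index 0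
  -- can be separated.
  let t' : ℕ → Set M := fun i => if i ∈ s then t i else Set.univ
  have ht' : ∀ i, MeasurableSet (t' i) := fun i => by
    by_cases h : i ∈ s <;> simp [t', h, ht]
  obtain ⟨n, hn⟩ : ∃ n, s ⊆ Finset.range (n + 1) :=
    ⟨s.sup id, fun i hi => Finset.mem_range.2 (Nat.lt_succ_of_le (Finset.le_sup (f := id) hi))⟩
  have h1 : (fun p : M × (ℕ → M) => seqCons p.1 p.2) ⁻¹' (Set.pi s t) =
      t' 0 ×ˢ Set.pi (Finset.range n) (fun i => t' (i + 1)) := by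
    ext p
    simp only [Set.mem_preimage, Set.mem_pi, Finset.mem_coe, Set.mem_prod, Finset.mem_range]
    constructor
    · intro h
      refine ⟨?_, fun i _ => ?_⟩
      · by_cases h0 : 0 ∈ s
        · simpa [t', h0] using h 0 h0
        · simp [t', h0]
      · by_cases h0 : i + 1 ∈ s
        · simpa [t', h0] using h (i + 1) h0
        · simp [t', h0]
    · rintro ⟨h0, h1⟩ i hi
      cases i with
      | zero => simpa [t', hi] using h0
      | succ i =>
        have := h1 i (by have := Finset.mem_range.1 (hn hi); omega)
        simpa [t', hi] using this
  rw [Measure.map_apply measurable_seqCons (MeasurableSet.pi s.countable_toSet fun i _ => ht i), h1,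
    Measure.prod_prod, Measure.infinitePi_pi _ fun i _ => ht' (i + 1), mul_comm,
    ← Finset.prod_range_succ' (fun i => ρ (t' i)),
    ← Finset.prod_subset hn (fun i _ hi => by simp [t', hi])]
  exact Finset.prod_congr rfl fun i hi => by simp [t', hi]

theorem lintegral_infinitePi_seqCons {M : Type*} [MeasurableSpace M] (ρ : Measure M)
    [IsProbabilityMeasure ρ] {F : (ℕ → M) → ℝ≥0∞} (hF : Measurable F) :
    ∫⁻ θ, F θ ∂(Measure.infinitePi fun _ : ℕ => ρ) =
      ∫⁻ m, ∫⁻ θ, F (seqCons m θ) ∂(Measure.infinitePi fun _ : ℕ => ρ) ∂ρ := by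
  conv_lhs => rw [← map_seqCons_infinitePi ρ]
  rw [lintegral_map hF measurable_seqCons, lintegral_prod _ (by fun_prop)]

variable {Q : Type*}

/-- The time of the `n`-th jump for a sequence of marks `(u_k, q_k)` with waiting times `u_k`. -/
def jumpTime (n : ℕ) (θ : ℕ → ℝ≥0 × Q) : ℝ≥0 := ∑ k ∈ Finset.range n, (θ k).1

/-- There are exactly `n` jumps up to time `s`. -/
def HasJumps (n : ℕ) (s : ℝ≥0) (θ : ℕ → ℝ≥0 × Q) : Prop :=
  jumpTime n θ ≤ s ∧ s < jumpTime (n + 1) θ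

theorem jumpTime_succ' (n : ℕ) (θ : ℕ → ℝ≥0 × Q) :
    jumpTime (n + 1) θ = (θ 0).1 + jumpTime n (seqTail θ) := by
  simp [jumpTime, Finset.sum_range_succ', add_comm]

theorem jumpTime_mono (θ : ℕ → ℝ≥0 × Q) : Monotone fun n => jumpTime n θ :=
  fun _ _ h => Finset.sum_le_sum_of_subset (Finset.range_mono h)

theorem hasJumps_zero {s : ℝ≥0} {θ : ℕ → ℝ≥0 × Q} : HasJumps 0 s θ ↔ s < (θ 0).1 := by
  simp [HasJumps, jumpTime]

/-- The recursion behind all inductions below: restart at the first jump. The first conjunct makes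
the truncated subtraction a true one. -/
theorem hasJumps_succ {n : ℕ} {s : ℝ≥0} {θ : ℕ → ℝ≥0 × Q} :
    HasJumps (n + 1) s θ ↔ (θ 0).1 ≤ s ∧ HasJumps n (s - (θ 0).1) (seqTail θ) := by
  simp only [HasJumps, jumpTime_succ' _ θ]
  constructor
  · rintro ⟨h1, h2⟩
    have h0 : (θ 0).1 ≤ s := le_self_add.trans h1
    exact ⟨h0, le_tsub_of_add_le_left h1, (tsub_lt_iff_left h0).2 h2⟩
  · rintro ⟨h0, h1, h2⟩
    exact ⟨(le_tsub_iff_left h0).1 h1, (tsub_lt_iff_left h0).1 h2⟩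

theorem HasJumps.eq {n m : ℕ} {s : ℝ≥0} {θ : ℕ → ℝ≥0 × Q} (hn : HasJumps n s θ)
    (hm : HasJumps m s θ) : n = m := by
  rcases lt_trichotomy n m with h | h | h
  · exact absurd (hn.2.trans_le (jumpTime_mono θ h)) (not_lt.2 hm.1)
  · exact h
  · exact absurd (hm.2.trans_le (jumpTime_mono θ h)) (not_lt.2 hn.1)

theorem exists_hasJumps {s : ℝ≥0} {θ : ℕ → ℝ≥0 × Q} (h : ∃ k, s < (θ k).1) :
    ∃ n, HasJumps n s θ := by
  classical
  have h' : ∃ n, s < jumpTime (n + 1) θ := by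
    obtain ⟨k, hk⟩ := h
    refine ⟨k, hk.trans_le ?_⟩
    exact Finset.single_le_sum (f := fun k => (θ k).1) (fun _ _ => zero_le)
      (Finset.self_mem_range_succ k)
  refine ⟨Nat.find h', ?_, Nat.find_spec h'⟩
  rcases hn : Nat.find h' with _ | n
  · simp [jumpTime]
  · exact not_lt.1 (Nat.find_min h' (m := n) (by omega))

variable [MeasurableSpace Q]

@[fun_prop]
theorem measurable_jumpTime (n : ℕ) : Measurable (jumpTime n : (ℕ → ℝ≥0 × Q) → ℝ≥0) := by
  unfold jumpTime
  fun_prop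

theorem measurableSet_hasJumps (n : ℕ) :
    MeasurableSet {p : ℝ≥0 × (ℕ → ℝ≥0 × Q) | HasJumps n p.1 p.2} :=
  (measurableSet_le (by fun_prop) (by fun_prop)).inter
    (measurableSet_lt (by fun_prop) (by fun_prop))

theorem measurableSet_hasJumps_right (n : ℕ) (s : ℝ≥0) :
    MeasurableSet {θ : ℕ → ℝ≥0 × Q | HasJumps n s θ} :=
  measurable_prodMk_left (measurableSet_hasJumps n)

/-- The marks seen after time `s`, if there are `n` jumps up to time `s`. -/
noncomputable def shiftMarks : ℕ → ℝ≥0 → (ℕ → ℝ≥0 × Q) → ℕ → ℝ≥0 × Q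
  | 0, s, θ => seqCons ((θ 0).1 - s, (θ 0).2) (seqTail θ)
  | n + 1, s, θ => shiftMarks n (s - (θ 0).1) (seqTail θ)

@[fun_prop]
theorem measurable_shiftMarks (n : ℕ) :
    Measurable fun p : ℝ≥0 × (ℕ → ℝ≥0 × Q) => shiftMarks n p.1 p.2 := by
  induction n with
  | zero =>
    simp only [shiftMarks]
    exact measurable_seqCons.comp (f := fun p : ℝ≥0 × (ℕ → ℝ≥0 × Q) =>
      (((p.2 0).1 - p.1, (p.2 0).2), seqTail p.2)) (by fun_prop)
  | succ n ih =>
    simp only [shiftMarks]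
    exact ih.comp (f := fun p : ℝ≥0 × (ℕ → ℝ≥0 × Q) => (p.1 - (p.2 0).1, seqTail p.2))
      (by fun_prop)

/-- The law of a mark is memoryless in its first component, the waiting time. -/
def IsMemoryless (ρ : Measure (ℝ≥0 × Q)) : Prop :=
  ∀ (s : ℝ≥0) (F : ℝ≥0 × Q → ℝ≥0∞), Measurable F →
    ∫⁻ m in {m | s < m.1}, F (m.1 - s, m.2) ∂ρ = ρ {m | s < m.1} * ∫⁻ m, F m ∂ρ

variable {ρ : Measure (ℝ≥0 × Q)} [IsProbabilityMeasure ρ]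

/-- Given that there are `n` jumps up to time `s`, the marks seen after time `s` are independent of
the marks of these `n` jumps, and distributed as the original marks. -/
theorem setLIntegral_shiftMarks (hρ : IsMemoryless ρ) (n : ℕ) :
    ∀ (s : ℝ≥0) (H : (ℕ → ℝ≥0 × Q) → (ℕ → ℝ≥0 × Q) → ℝ≥0∞), Measurable (Function.uncurry H) →
    (∀ θ θ', HasJumps n s θ → HasJumps n s θ' → (∀ k < n, θ k = θ' k) → H θ = H θ') →
    ∫⁻ θ in {θ | HasJumps n s θ}, H θ (shiftMarks n s θ) ∂(Measure.infinitePi fun _ : ℕ => ρ) =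
      ∫⁻ θ in {θ | HasJumps n s θ}, ∫⁻ η, H θ η ∂(Measure.infinitePi fun _ : ℕ => ρ)
        ∂(Measure.infinitePi fun _ : ℕ => ρ) := by
  induction n with
  | zero =>
    intro s H hH hdep
    -- Without a jump up to `s` the functional `H` does not see `θ`, so it can be frozen at one
    -- `θ₀`; what remains is memorylessness of the first waiting time.
    rcases Set.eq_empty_or_nonempty {θ : ℕ → ℝ≥0 × Q | HasJumps 0 s θ} with he | ⟨θ₀, hθ₀⟩
    · simp [he]
    have hH₀ : Measurable (H θ₀) := hH.comp measurable_prodMk_left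
    have hms := measurableSet_hasJumps_right (Q := Q) 0 s
    have hm1 : MeasurableSet {m : ℝ≥0 × Q | s < m.1} := measurableSet_lt (by fun_prop) (by fun_prop)
    have e1 : ∫⁻ θ in {θ | HasJumps 0 s θ}, H θ (shiftMarks 0 s θ)
        ∂(Measure.infinitePi fun _ : ℕ => ρ) = ∫⁻ θ in {θ | HasJumps 0 s θ},
          H θ₀ (shiftMarks 0 s θ) ∂(Measure.infinitePi fun _ : ℕ => ρ) :=
      setLIntegral_congr_fun hms fun θ hθ => by rw [hdep θ θ₀ hθ hθ₀ (by simp)]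
    have e2 : ∫⁻ θ in {θ | HasJumps 0 s θ}, ∫⁻ η, H θ η ∂(Measure.infinitePi fun _ : ℕ => ρ)
        ∂(Measure.infinitePi fun _ : ℕ => ρ) = ∫⁻ θ in {θ | HasJumps 0 s θ},
          ∫⁻ η, H θ₀ η ∂(Measure.infinitePi fun _ : ℕ => ρ)
        ∂(Measure.infinitePi fun _ : ℕ => ρ) :=
      setLIntegral_congr_fun hms fun θ hθ => by rw [hdep θ θ₀ hθ hθ₀ (by simp)]
    have hJ : (Measure.infinitePi fun _ : ℕ => ρ) {θ : ℕ → ℝ≥0 × Q | HasJumps 0 s θ} =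
        ρ {m | s < m.1} := by
      rw [← (measurePreserving_eval_infinitePi (fun _ : ℕ => ρ) 0).measure_preimage
        hm1.nullMeasurableSet]
      simp only [hasJumps_zero]
      rfl
    have hsh : Measurable fun θ : ℕ → ℝ≥0 × Q => H θ₀ (shiftMarks 0 s θ) :=
      hH₀.comp ((measurable_shiftMarks 0).comp measurable_prodMk_left)
    rw [e1, e2, setLIntegral_const, hJ, ← lintegral_indicator hms,
      lintegral_infinitePi_seqCons ρ (hsh.indicator hms), lintegral_infinitePi_seqCons ρ hH₀,
      mul_comm, ← hρ s _ (by fun_prop), ← lintegral_indicator hm1]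
    refine lintegral_congr fun m => ?_
    by_cases hm : s < m.1 <;> simp [Set.indicator, hasJumps_zero, hm, shiftMarks]
  | succ n ih =>
    intro s H hH hdep
    have hms := measurableSet_hasJumps_right (Q := Q) (n + 1) s
    have hsh : Measurable fun θ : ℕ → ℝ≥0 × Q => H θ (shiftMarks (n + 1) s θ) :=
      hH.comp (measurable_id.prodMk ((measurable_shiftMarks (n + 1)).comp measurable_prodMk_left))
    have hr : Measurable fun θ : ℕ → ℝ≥0 × Q => ∫⁻ η, H θ η ∂(Measure.infinitePi fun _ : ℕ => ρ) :=
      hH.lintegral_prod_right'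
    rw [← lintegral_indicator hms, ← lintegral_indicator hms,
      lintegral_infinitePi_seqCons ρ (hsh.indicator hms),
      lintegral_infinitePi_seqCons ρ (hr.indicator hms)]
    refine lintegral_congr fun m => ?_
    by_cases hm : m.1 ≤ s
    · have hms' := measurableSet_hasJumps_right (Q := Q) n (s - m.1)
      -- With the first mark `m` fixed, the claim is the one for `n` jumps in the time left after
      -- `m.1`.
      have := ih (s - m.1) (fun θ η => H (seqCons m θ) η)
        (hH.comp (f := fun p : (ℕ → ℝ≥0 × Q) × (ℕ → ℝ≥0 × Q) => (seqCons m p.1, p.2))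
          ((measurable_seqCons.comp (measurable_const.prodMk measurable_fst)).prodMk measurable_snd))
        (fun θ θ' hθ hθ' hk => hdep _ _ (hasJumps_succ.2 ⟨hm, hθ⟩) (hasJumps_succ.2 ⟨hm, hθ'⟩) (by
          rintro (_ | k) hk'
          · rfl
          · exact hk k (by omega)))
      rw [← lintegral_indicator hms', ← lintegral_indicator hms'] at this
      have hj : ∀ θ, HasJumps (n + 1) s (seqCons m θ) ↔ HasJumps n (s - m.1) θ := fun θ => by
        simp [hasJumps_succ, hm]
      refine (lintegral_congr fun θ => ?_).trans (this.trans (lintegral_congr fun θ => ?_)) <;>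
        by_cases hθ : HasJumps n (s - m.1) θ <;> simp [Set.indicator, hj, hθ, shiftMarks]
    · simp [Set.indicator, hasJumps_succ, hm]

theorem lintegral_eq_tsum_hasJumps {μ : Measure (ℕ → ℝ≥0 × Q)} {s : ℝ≥0}
    (hex : ∀ᵐ θ ∂μ, ∃ n, HasJumps n s θ) (F : (ℕ → ℝ≥0 × Q) → ℝ≥0∞) :
    ∫⁻ θ, F θ ∂μ = ∑' n, ∫⁻ θ in {θ | HasJumps n s θ}, F θ ∂μ := by
  rw [← lintegral_iUnion (fun n => measurableSet_hasJumps_right n s)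
    fun i j hij => Set.disjoint_left.2 fun θ hi hj => hij (HasJumps.eq hi hj)]
  rw [Measure.restrict_eq_self_of_ae_mem]
  filter_upwards [hex] with θ hθ
  simpa using hθ

/-- A functional of the marks that splits into the past and the future of `s` may be integrated
with an independent copy of the future. -/
theorem lintegral_shiftMarks (hρ : IsMemoryless ρ) {s : ℝ≥0}
    (hex : ∀ᵐ θ ∂(Measure.infinitePi fun _ : ℕ => ρ), ∃ n, HasJumps n s θ)
    {F : (ℕ → ℝ≥0 × Q) → ℝ≥0∞} {H : (ℕ → ℝ≥0 × Q) → (ℕ → ℝ≥0 × Q) → ℝ≥0∞}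
    (hH : Measurable (Function.uncurry H))
    (hdep : ∀ n θ θ', HasJumps n s θ → HasJumps n s θ' → (∀ k < n, θ k = θ' k) → H θ = H θ')
    (hF : ∀ᵐ θ ∂(Measure.infinitePi fun _ : ℕ => ρ), ∀ n, HasJumps n s θ →
      F θ = H θ (shiftMarks n s θ)) :
    ∫⁻ θ, F θ ∂(Measure.infinitePi fun _ : ℕ => ρ) =
      ∫⁻ θ, ∫⁻ η, H θ η ∂(Measure.infinitePi fun _ : ℕ => ρ)
        ∂(Measure.infinitePi fun _ : ℕ => ρ) := by
  rw [lintegral_eq_tsum_hasJumps hex, lintegral_eq_tsum_hasJumps hex]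
  refine tsum_congr fun n => ?_
  rw [← setLIntegral_shiftMarks hρ n s H hH (hdep n)]
  refine setLIntegral_congr_fun_ae (measurableSet_hasJumps_right n s) ?_
  filter_upwards [hF] with θ hθ using hθ n

/-- A jump occurs after any given time if long waiting times are possible. -/
theorem ae_exists_hasJumps (hρ : ∀ s : ℝ≥0, ρ {m | m.1 ≤ s} < 1) :
    ∀ᵐ θ ∂(Measure.infinitePi fun _ : ℕ => ρ), ∀ s, ∃ n, HasJumps n s θ := by
  have hn : ∀ j : ℕ, ∀ᵐ θ ∂(Measure.infinitePi fun _ : ℕ => ρ), ∃ k, (j : ℝ≥0) < (θ k).1 := by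
    intro j
    rw [ae_iff]
    push Not
    have hm : MeasurableSet {m : ℝ≥0 × Q | m.1 ≤ j} :=
      measurableSet_le measurable_fst measurable_const
    -- If all waiting times are at most `j`, so are the first `n`; by independence this has
    -- probability at most the `n`-th power of a number below 1.
    have hle : ∀ n : ℕ, (Measure.infinitePi fun _ : ℕ => ρ)
        {θ : ℕ → ℝ≥0 × Q | ∀ k, (θ k).1 ≤ (j : ℝ≥0)} ≤ ρ {m | m.1 ≤ (j : ℝ≥0)} ^ n := by
      intro n
      have := Measure.infinitePi_pi (fun _ : ℕ => ρ) (s := Finset.range n) (t := fun _ =>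
        {m : ℝ≥0 × Q | m.1 ≤ j}) (fun _ _ => hm)
      rw [Finset.prod_const, Finset.card_range] at this
      rw [← this]
      exact measure_mono fun θ hθ k _ => hθ k
    exact le_antisymm (ge_of_tendsto' (ENNReal.tendsto_pow_atTop_nhds_zero_of_lt_one (hρ j)) hle)
      zero_le
  filter_upwards [ae_all_iff.2 hn] with θ hθ s
  obtain ⟨j, hj⟩ := exists_nat_gt s
  obtain ⟨k, hk⟩ := hθ j
  exact exists_hasJumps ⟨k, hj.trans hk⟩

end MarkedJumps

/-! ### A flow interrupted by marked jumps, and its transition function. -/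

section JumpKernel

variable {E Q : Type*} [MeasurableSpace E] [MeasurableSpace Q]

/-- Follow the flow `G` until the first jump, and apply `S`. The triple consists of the remaining
time, the remaining marks, and the state. -/
noncomputable def jumpStep (G : Kernel (ℝ≥0 × E) E) (S : Q × E → E) :
    Kernel (ℝ≥0 × (ℕ → ℝ≥0 × Q) × E) (ℝ≥0 × (ℕ → ℝ≥0 × Q) × E) :=
  (Kernel.id ×ₖ G.comap (fun p => ((p.2.1 0).1, p.2.2)) (by fun_prop)).map
    fun r => (r.1.1 - (r.1.2.1 0).1, seqTail r.1.2.1, S ((r.1.2.1 0).2, r.2))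

open Classical in
/-- Follow the flow `G`, with exactly `n` jumps at the times given by the marks, at which `S` is
applied. -/
noncomputable def jumpKernel (G : Kernel (ℝ≥0 × E) E) (S : Q × E → E) :
    ℕ → Kernel (ℝ≥0 × (ℕ → ℝ≥0 × Q) × E) E
  | 0 => Kernel.piecewise (s := {p | p.1 < (p.2.1 0).1})
      (measurableSet_lt (by fun_prop) (by fun_prop))
      (G.comap (fun p => (p.1, p.2.2)) (by fun_prop)) 0
  | n + 1 => Kernel.piecewise (s := {p | (p.2.1 0).1 ≤ p.1})
      (measurableSet_le (by fun_prop) (by fun_prop))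
      (jumpKernel G S n ∘ₖ jumpStep G S) 0

/-- Follow the flow `G`, and apply `S` at the jumps given by the marks. -/
noncomputable def markedFlow (G : Kernel (ℝ≥0 × E) E) (S : Q × E → E) :
    Kernel (ℝ≥0 × (ℕ → ℝ≥0 × Q) × E) E :=
  Kernel.sum (jumpKernel G S)

variable (G : Kernel (ℝ≥0 × E) E) (S : Q × E → E)

/-- `jumpKernel G S n` vanishes unless exactly `n` jumps occur, so the sum has at most one nonzero
term. Together with `lintegral_markedFlow_of_le` this gives the recursion through which `markedFlow`
is used. -/
theorem lintegral_markedFlow_of_lt {f : E → ℝ≥0∞} {t : ℝ≥0} {θ : ℕ → ℝ≥0 × Q} (h : t < (θ 0).1)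
    (y : E) : ∫⁻ z, f z ∂markedFlow G S (t, θ, y) = ∫⁻ z, f z ∂G (t, y) := by
  rw [markedFlow, Kernel.sum_apply, lintegral_sum_measure, tsum_eq_single 0]
  · simp [jumpKernel, Kernel.piecewise_apply, h, Kernel.comap_apply]
  · rintro (_ | n) hn
    · exact absurd rfl hn
    · simp [jumpKernel, Kernel.piecewise_apply, not_le.2 h]

variable [IsMarkovKernel G]

instance : IsSFiniteKernel (jumpStep G S) := by
  unfold jumpStep
  infer_instance

instance (n : ℕ) : IsSFiniteKernel (jumpKernel G S n) := by
  induction n with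
  | zero => unfold jumpKernel; infer_instance
  | succ n ih => unfold jumpKernel; infer_instance

instance : IsSFiniteKernel (markedFlow G S) := by
  unfold markedFlow
  infer_instance

variable {S}

theorem lintegral_jumpStep (hS : Measurable S) {f : ℝ≥0 × (ℕ → ℝ≥0 × Q) × E → ℝ≥0∞}
    (hf : Measurable f) (t : ℝ≥0) (θ : ℕ → ℝ≥0 × Q) (y : E) :
    ∫⁻ p, f p ∂jumpStep G S (t, θ, y) =
      ∫⁻ z, f (t - (θ 0).1, seqTail θ, S ((θ 0).2, z)) ∂G ((θ 0).1, y) := by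
  have hm : Measurable fun r : (ℝ≥0 × (ℕ → ℝ≥0 × Q) × E) × E =>
      (r.1.1 - (r.1.2.1 0).1, seqTail r.1.2.1, S ((r.1.2.1 0).2, r.2)) := by fun_prop
  rw [jumpStep, Kernel.lintegral_map _ hm _ hf]
  exact Kernel.lintegral_id_prod (hf.comp hm) _ _

theorem lintegral_markedFlow_of_le (hS : Measurable S) {f : E → ℝ≥0∞} (hf : Measurable f) {t : ℝ≥0}
    {θ : ℕ → ℝ≥0 × Q} (h : (θ 0).1 ≤ t) (y : E) :
    ∫⁻ z, f z ∂markedFlow G S (t, θ, y) =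
      ∫⁻ z, ∫⁻ w, f w ∂markedFlow G S (t - (θ 0).1, seqTail θ, S ((θ 0).2, z))
        ∂G ((θ 0).1, y) := by
  have hm : ∀ n, Measurable fun p => ∫⁻ w, f w ∂jumpKernel G S n p := fun n =>
    hf.lintegral_kernel
  rw [markedFlow, Kernel.sum_apply, lintegral_sum_measure, tsum_eq_zero_add' ENNReal.summable]
  have h0 : ∫⁻ z, f z ∂jumpKernel G S 0 (t, θ, y) = 0 := by
    simp [jumpKernel, Kernel.piecewise_apply, not_lt.2 h]
  have h1 : ∀ n, ∫⁻ z, f z ∂jumpKernel G S (n + 1) (t, θ, y) = ∫⁻ z, ∫⁻ w, f w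
      ∂jumpKernel G S n (t - (θ 0).1, seqTail θ, S ((θ 0).2, z)) ∂G ((θ 0).1, y) := by
    intro n
    simp only [jumpKernel, Kernel.piecewise_apply, Set.mem_ofPred_eq, h, if_true]
    rw [Kernel.lintegral_comp _ _ _ hf, lintegral_jumpStep G hS (hm n)]
  simp_rw [h0, h1, zero_add, Kernel.sum_apply, lintegral_sum_measure]
  rw [lintegral_tsum]
  exact fun n => ((hm n).comp (by fun_prop)).aemeasurable

/-- A finite number of jumps is essential: if all jump times stay below `t`, every summand is zero.
-/
theorem markedFlow_univ (hS : Measurable S) {n : ℕ} : ∀ {t : ℝ≥0} {θ : ℕ → ℝ≥0 × Q},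
    HasJumps n t θ → ∀ y, markedFlow G S (t, θ, y) Set.univ = 1 := by
  simp_rw [← lintegral_one]
  induction n with
  | zero =>
    intro t θ h y
    simp [lintegral_markedFlow_of_lt G S (hasJumps_zero.1 h)]
  | succ n ih =>
    intro t θ h y
    obtain ⟨h0, h1⟩ := hasJumps_succ.1 h
    simp_rw [lintegral_markedFlow_of_le G hS measurable_const h0, ih h1]
    simp

/-- Marks of jumps after `t` are not read. This is the dependence hypothesis that
`lintegral_shiftMarks` asks of the past. -/
theorem lintegral_markedFlow_congr (hS : Measurable S) {f : E → ℝ≥0∞} (hf : Measurable f) {n : ℕ} :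
    ∀ {t : ℝ≥0} {θ θ' : ℕ → ℝ≥0 × Q}, HasJumps n t θ → HasJumps n t θ' →
    (∀ k < n, θ k = θ' k) → ∀ y,
      ∫⁻ z, f z ∂markedFlow G S (t, θ, y) = ∫⁻ z, f z ∂markedFlow G S (t, θ', y) := by
  induction n with
  | zero =>
    intro t θ θ' h h' _ y
    rw [lintegral_markedFlow_of_lt G S (hasJumps_zero.1 h),
      lintegral_markedFlow_of_lt G S (hasJumps_zero.1 h')]
  | succ n ih =>
    intro t θ θ' h h' hk y
    obtain ⟨h0, h1⟩ := hasJumps_succ.1 h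
    obtain ⟨h0', h1'⟩ := hasJumps_succ.1 h'
    rw [lintegral_markedFlow_of_le G hS hf h0, lintegral_markedFlow_of_le G hS hf h0']
    have h00 := hk 0 (Nat.succ_pos n)
    rw [← h00] at h1' ⊢
    exact lintegral_congr fun z => ih h1 h1' (fun k hk' => hk (k + 1) (by omega)) _

/-- `G` is a semigroup in its first argument. -/
structure IsFlow (G : Kernel (ℝ≥0 × E) E) : Prop where
  zero : ∀ y, G (0, y) = Measure.dirac y
  add : ∀ (s t : ℝ≥0) (y : E) (f : E → ℝ≥0∞), Measurable f →
    ∫⁻ z, f z ∂G (s + t, y) = ∫⁻ w, ∫⁻ z, f z ∂G (t, w) ∂G (s, y)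

variable {G}

/-- Chapman–Kolmogorov for frozen marks. If no jump precedes `s`, the semigroup property of `G`
splits the first stretch at `s`; otherwise restart at the first jump. -/
theorem lintegral_markedFlow_add (hG : IsFlow G) (hS : Measurable S) {f : E → ℝ≥0∞}
    (hf : Measurable f) (t : ℝ≥0) {n : ℕ} : ∀ {s : ℝ≥0} {θ : ℕ → ℝ≥0 × Q}, HasJumps n s θ → ∀ y,
      ∫⁻ z, f z ∂markedFlow G S (s + t, θ, y) =
        ∫⁻ w, ∫⁻ z, f z ∂markedFlow G S (t, shiftMarks n s θ, w) ∂markedFlow G S (s, θ, y) := by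
  have hm : Measurable fun p => ∫⁻ z, f z ∂markedFlow G S p := hf.lintegral_kernel
  induction n with
  | zero =>
    intro s θ h y
    have hs := hasJumps_zero.1 h
    rw [lintegral_markedFlow_of_lt G S hs]
    rcases lt_or_ge (s + t) (θ 0).1 with hst | hst
    · rw [lintegral_markedFlow_of_lt G S hst, hG.add s t y f hf]
      refine lintegral_congr fun w => ?_
      rw [lintegral_markedFlow_of_lt G S]
      simpa [shiftMarks] using lt_tsub_iff_left.2 hst
    · rw [lintegral_markedFlow_of_le G hS hf hst]
      -- `u` is the part of the first waiting time left after `s`.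
      obtain ⟨u, hu⟩ := exists_add_of_le hs.le
      rw [hu, hG.add s u y _ (by fun_prop)]
      have hut : u ≤ t := by rw [hu] at hst; exact (add_le_add_iff_left s).1 hst
      refine lintegral_congr fun w => ?_
      have e : ((shiftMarks 0 s θ) 0).1 = u := by simp [shiftMarks, hu]
      rw [lintegral_markedFlow_of_le G hS hf (by rw [e]; exact hut), e]
      simp [shiftMarks, add_tsub_add_eq_tsub_left]
  | succ n ih =>
    intro s θ h y
    obtain ⟨h0, h1⟩ := hasJumps_succ.1 h
    rw [lintegral_markedFlow_of_le G hS hf (h0.trans le_self_add),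
      lintegral_markedFlow_of_le G hS (f := fun w => ∫⁻ z, f z
        ∂markedFlow G S (t, shiftMarks (n + 1) s θ, w)) (hm.comp (by fun_prop)) h0]
    refine lintegral_congr fun w => ?_
    rw [tsub_add_eq_add_tsub h0 |>.symm, ih h1]
    rfl

section transition

variable (G S) (ρ : Measure (ℝ≥0 × Q)) [IsProbabilityMeasure ρ]

/-- The transition function of the process that follows the flow `G` and jumps according to `S` at
times and with marks that are drawn independently from `ρ`. -/
noncomputable def jumpTransition (t : ℝ≥0) : Kernel E E :=
  markedFlow G S ∘ₖ ((Kernel.const E (Measure.infinitePi fun _ : ℕ => ρ) ×ₖ Kernel.id).map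
    fun p => (t, p.1, p.2))

variable {S}

theorem lintegral_jumpTransition {f : E → ℝ≥0∞} (hf : Measurable f) (t : ℝ≥0) (y : E) :
    ∫⁻ z, f z ∂jumpTransition G S ρ t y =
      ∫⁻ θ, ∫⁻ z, f z ∂markedFlow G S (t, θ, y) ∂(Measure.infinitePi fun _ : ℕ => ρ) := by
  have hm : Measurable fun p => ∫⁻ z, f z ∂markedFlow G S p := hf.lintegral_kernel
  rw [jumpTransition, Kernel.lintegral_comp _ _ _ hf, Kernel.lintegral_map _ (by fun_prop) _ hm]
  exact Kernel.lintegral_prod_id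
    (hm.comp (f := fun p : (ℕ → ℝ≥0 × Q) × E => (t, p.1, p.2)) (by fun_prop)) _ _

variable {G ρ}

theorem isTransitionFunction_jumpTransition (hG : IsFlow G) (hS : Measurable S)
    (hρ : IsMemoryless ρ) (hex : ∀ s : ℝ≥0, ρ {m | m.1 ≤ s} < 1) (h0 : ρ {m | m.1 = 0} = 0) :
    IsTransitionFunction (jumpTransition G S ρ) where
  markov t := ⟨fun y => ⟨by
    rw [← lintegral_one, lintegral_jumpTransition G ρ measurable_const]
    have : ∀ᵐ θ ∂(Measure.infinitePi fun _ : ℕ => ρ),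
        ∫⁻ _, 1 ∂markedFlow G S (t, θ, y) = 1 := by
      filter_upwards [ae_exists_hasJumps hex] with θ hθ
      obtain ⟨n, hn⟩ := hθ t
      rw [lintegral_one, markedFlow_univ G hS hn]
    rw [lintegral_congr_ae this]
    simp⟩⟩
  zero := by
    ext y A hA
    have hind : Measurable (A.indicator (1 : E → ℝ≥0∞)) := measurable_one.indicator hA
    rw [← lintegral_indicator_one hA, lintegral_jumpTransition G ρ hind]
    have : ∀ᵐ θ ∂(Measure.infinitePi fun _ : ℕ => ρ),
        ∫⁻ z, A.indicator 1 z ∂markedFlow G S (0, θ, y) = A.indicator 1 y := by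
      have h0' : ∀ᵐ m ∂ρ, m.1 ≠ 0 := by simpa [ae_iff] using h0
      filter_upwards [(measurePreserving_eval_infinitePi (fun _ : ℕ => ρ)
        0).quasiMeasurePreserving.ae h0'] with θ hθ
      rw [lintegral_markedFlow_of_lt G S (pos_iff_ne_zero.2 hθ), hG.zero, lintegral_dirac' _ hind]
    rw [lintegral_congr_ae this]
    simp [Kernel.id_apply, Measure.dirac_apply' _ hA]
  add s t := by
    ext y A hA
    have hind : Measurable (A.indicator (1 : E → ℝ≥0∞)) := measurable_one.indicator hA
    have hm : Measurable fun p => ∫⁻ z, A.indicator 1 z ∂markedFlow G S p := hind.lintegral_kernel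
    have hm' : Measurable fun w : E => ∫⁻ η, ∫⁻ z, A.indicator 1 z ∂markedFlow G S (t, η, w)
        ∂(Measure.infinitePi fun _ : ℕ => ρ) :=
      Measurable.lintegral_prod_right' (hm.comp (f := fun p : E × (ℕ → ℝ≥0 × Q) => (t, p.2, p.1))
        (by fun_prop))
    rw [← lintegral_indicator_one hA, ← lintegral_indicator_one hA, Kernel.lintegral_comp _ _ _ hind]
    simp_rw [lintegral_jumpTransition G ρ hind]
    rw [lintegral_jumpTransition G ρ hm']
    -- The marks after `s` are replaced by an independent copy `η`, which turns Chapman–Kolmogorov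
    -- for frozen marks into the semigroup property.
    rw [lintegral_shiftMarks hρ (s := s) ((ae_exists_hasJumps hex).mono fun θ h => h s)
      (H := fun θ η => ∫⁻ w, ∫⁻ z, A.indicator 1 z ∂markedFlow G S (t, η, w)
        ∂markedFlow G S (s, θ, y))]
    · refine lintegral_congr fun θ => ?_
      exact lintegral_lintegral_swap (hm.comp (by fun_prop)).aemeasurable
    · let K : Kernel ((ℕ → ℝ≥0 × Q) × (ℕ → ℝ≥0 × Q)) E :=
        (markedFlow G S).comap (fun p => (s, p.1, y)) (by fun_prop)
      exact Measurable.lintegral_kernel_prod_right (κ := K) (f := fun p w => ∫⁻ z, A.indicator 1 z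
        ∂markedFlow G S (t, p.2, w)) (hm.comp (by fun_prop))
    · intro n θ θ' h h' hk
      funext η
      exact lintegral_markedFlow_congr G hS (hm.comp (by fun_prop)) h h' hk y
    · exact ae_of_all _ fun θ n h => lintegral_markedFlow_add hG hS hind t h y

end transition

end JumpKernel

/-! ### Lack of memory of the exponential law. -/

section Exponential

/-- The exponential distribution with parameter `δ`, as a measure on `ℝ≥0`. -/
noncomputable def expMeasureNNReal (δ : ℝ) : Measure ℝ≥0 := (expMeasure δ).map Real.toNNReal

variable {δ : ℝ}

theorem isProbabilityMeasure_expMeasureNNReal (hδ : 0 < δ) :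
    IsProbabilityMeasure (expMeasureNNReal δ) := by
  have := isProbabilityMeasure_expMeasure hδ
  exact Measure.isProbabilityMeasure_map measurable_real_toNNReal.aemeasurable

theorem expMeasureNNReal_real_Iic (hδ : 0 < δ) (s : ℝ≥0) :
    (expMeasureNNReal δ).real (Set.Iic s) = 1 - Real.exp (-(δ * s)) := by
  have := isProbabilityMeasure_expMeasure hδ
  have h : Real.toNNReal ⁻¹' Set.Iic s = Set.Iic (s : ℝ) := by
    ext x
    simp [Real.toNNReal_le_iff_le_coe]
  rw [expMeasureNNReal, map_measureReal_apply measurable_real_toNNReal measurableSet_Iic, h,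
    ← cdf_eq_real, cdf_expMeasure_eq hδ, if_pos s.coe_nonneg]

/-- Compared on half-lines, where the probability of `(s, s + r]` is `exp (-δ s) (1 - exp (-δ r))`.
-/
theorem map_sub_restrict_expMeasureNNReal (hδ : 0 < δ) (s : ℝ≥0) :
    ((expMeasureNNReal δ).restrict (Set.Ioi s)).map (fun u => u - s) =
      expMeasureNNReal δ (Set.Ioi s) • expMeasureNNReal δ := by
  have := isProbabilityMeasure_expMeasureNNReal hδ
  refine Measure.ext_of_Iic _ _ fun r => ?_
  have h : (fun u : ℝ≥0 => u - s) ⁻¹' Set.Iic r ∩ Set.Ioi s = Set.Iic (s + r) \ Set.Iic s := by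
    ext u
    simp [add_comm, and_comm]
  rw [Measure.map_apply (by fun_prop) measurableSet_Iic,
    Measure.restrict_apply ((by fun_prop : Measurable fun u : ℝ≥0 => u - s) measurableSet_Iic), h,
    Measure.smul_apply, smul_eq_mul, ← ENNReal.toReal_eq_toReal_iff' (measure_ne_top _ _)
      (ENNReal.mul_ne_top (measure_ne_top _ _) (measure_ne_top _ _)), ENNReal.toReal_mul]
  simp only [← measureReal_def]
  rw [measureReal_sdiff (Set.Iic_subset_Iic.2 le_self_add) measurableSet_Iic, ← Set.compl_Iic,
    probReal_compl_eq_one_sub measurableSet_Iic]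
  simp only [expMeasureNNReal_real_Iic hδ, NNReal.coe_add, mul_add, neg_add, Real.exp_add]
  ring

variable {Q : Type*} [MeasurableSpace Q]

theorem isMemoryless_expMeasureNNReal_prod (hδ : 0 < δ) (ν : Measure Q) [IsProbabilityMeasure ν] :
    IsMemoryless ((expMeasureNNReal δ).prod ν) := by
  have := isProbabilityMeasure_expMeasureNNReal hδ
  intro s F hF
  have hset : {m : ℝ≥0 × Q | s < m.1} = Set.Ioi s ×ˢ Set.univ := by ext; simp
  rw [hset, Measure.prod_prod, measure_univ, mul_one, ← Measure.prod_restrict,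
    Measure.restrict_univ, lintegral_prod_symm _ (by fun_prop), lintegral_prod_symm _ (by fun_prop),
    ← lintegral_const_mul _ (by fun_prop)]
  refine lintegral_congr fun q => ?_
  rw [← smul_eq_mul, ← lintegral_smul_measure, ← map_sub_restrict_expMeasureNNReal hδ,
    lintegral_map (by fun_prop) (by fun_prop)]

theorem expMeasureNNReal_prod_le_lt_one (hδ : 0 < δ) (ν : Measure Q) [IsProbabilityMeasure ν]
    (s : ℝ≥0) : ((expMeasureNNReal δ).prod ν) {m | m.1 ≤ s} < 1 := by
  have := isProbabilityMeasure_expMeasureNNReal hδ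
  have hset : {m : ℝ≥0 × Q | m.1 ≤ s} = Set.Iic s ×ˢ Set.univ := by ext; simp
  rw [hset, Measure.prod_prod, measure_univ, mul_one, ← ENNReal.toReal_lt_toReal
    (measure_ne_top _ _) ENNReal.one_ne_top, ← measureReal_def, expMeasureNNReal_real_Iic hδ]
  simp [Real.exp_pos]

theorem expMeasureNNReal_prod_eq_zero (hδ : 0 < δ) (ν : Measure Q) [IsProbabilityMeasure ν] :
    ((expMeasureNNReal δ).prod ν) {m | m.1 = 0} = 0 := by
  have := isProbabilityMeasure_expMeasureNNReal hδ
  have hset : {m : ℝ≥0 × Q | m.1 = 0} = Set.Iic 0 ×ˢ Set.univ := by ext; simp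
  rw [hset, Measure.prod_prod, measure_univ, mul_one, ← measureReal_eq_zero_iff,
    expMeasureNNReal_real_Iic hδ]
  simp

end Exponential

/-! ### Gaussian increments. -/

section Gaussian

/-- The law of an `N`-dimensional Brownian motion at time `t`. -/
noncomputable def gaussianConfig (N : ℕ) (t : ℝ≥0) : Measure (Fin N → ℝ) :=
  Measure.pi fun _ => gaussianReal 0 t

instance (N : ℕ) (t : ℝ≥0) : IsProbabilityMeasure (gaussianConfig N t) := by
  unfold gaussianConfig
  infer_instance

variable {N : ℕ}

/-- Brownian scaling. All times share one noise law, transformed measurably in `t`, so that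
`centeredGaussian` is a kernel in time and state jointly. -/
theorem gaussianConfig_map_sqrt_mul (t : ℝ≥0) :
    (gaussianConfig N 1).map (fun z i => Real.sqrt t * z i) = gaussianConfig N t := by
  unfold gaussianConfig
  have h : (gaussianReal 0 1).map (Real.sqrt t * ·) = gaussianReal 0 t := by
    rw [gaussianReal_map_const_mul]
    congr 1
    · simp
    · ext
      simp
  rw [Measure.pi_map_pi (fun _ => by fun_prop), h]

theorem lintegral_gaussianConfig_add (s t : ℝ≥0) {f : (Fin N → ℝ) → ℝ≥0∞} (hf : Measurable f) :
    ∫⁻ z, f z ∂gaussianConfig N (s + t) =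
      ∫⁻ z, ∫⁻ w, f (z + w) ∂gaussianConfig N t ∂gaussianConfig N s := by
  have h : ((gaussianConfig N s).prod (gaussianConfig N t)).map (fun p => p.1 + p.2) =
      gaussianConfig N (s + t) := by
    have h1 := (measurePreserving_arrowProdEquivProdArrow ℝ ℝ (Fin N)
      (fun _ => gaussianReal 0 s) (fun _ => gaussianReal 0 t)).map_eq
    have h2 : ((gaussianReal 0 s).prod (gaussianReal 0 t)).map (fun p => p.1 + p.2) =
        gaussianReal 0 (s + t) := by
      simpa [Measure.conv] using gaussianReal_conv_gaussianReal (m₁ := 0) (m₂ := 0) (v₁ := s)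
        (v₂ := t)
    unfold gaussianConfig
    rw [← h1, Measure.map_map (by fun_prop) (MeasurableEquiv.measurable _), ← h2,
      ← Measure.pi_map_pi (fun _ => by fun_prop)]
    rfl
  rw [← h, lintegral_map hf (by fun_prop), lintegral_prod _ (by fun_prop)]

end Gaussian

/-! ### Configurations up to translation. -/

section Particles

variable {N : ℕ}

@[fun_prop]
theorem measurable_centerOfMass : Measurable (centerOfMass : (Fin N → ℝ) → ℝ) := by
  unfold centerOfMass
  fun_prop

@[fun_prop]
theorem measurable_fromCenter : Measurable (fromCenter : (Fin N → ℝ) → CenteredConfig N) :=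
  Measurable.subtype_mk (measurable_pi_lambda _ fun i =>
    (measurable_pi_apply i).sub measurable_centerOfMass)

theorem fromCenter_val_apply (x : Fin N → ℝ) (i : Fin N) :
    (fromCenter x).1 i = x i - centerOfMass x := rfl

/-- Differences determine the centred configuration: summing `x i - x j` over `j` gives `N` times
the centred coordinate. -/
theorem fromCenter_eq_iff {x y : Fin N → ℝ} :
    fromCenter x = fromCenter y ↔ ∀ i j, x i - x j = y i - y j := by
  constructor
  · intro h i j
    have hi := congrFun (congrArg Subtype.val h) i
    have hj := congrFun (congrArg Subtype.val h) j
    simp only [fromCenter_val_apply] at hi hj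
    linarith
  · intro h
    refine Subtype.ext (funext fun i => ?_)
    have hN : (N : ℝ) ≠ 0 := by
      have := i.pos
      positivity
    have hsum : ∑ j, (x i - x j) = ∑ j, (y i - y j) := Finset.sum_congr rfl fun j _ => h i j
    simp only [Finset.sum_sub_distrib, Finset.sum_const, Finset.card_univ, Fintype.card_fin,
      nsmul_eq_mul] at hsum
    simp only [fromCenter_val_apply, centerOfMass]
    field_simp
    linarith

theorem fromCenter_sub_apply (x : Fin N → ℝ) (i j : Fin N) :
    (fromCenter x).1 i - (fromCenter x).1 j = x i - x j := by
  simp [fromCenter_val_apply]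

theorem fromCenter_val (y : CenteredConfig N) : fromCenter y.1 = y :=
  Subtype.ext (funext fun i => by rw [fromCenter_val_apply, y.2, sub_zero])

/-- With `fromCenter_synchronize`, this says that both displacements and jumps descend to centred
configurations; hence the centred process is autonomous. -/
theorem fromCenter_fromCenter_add (x z : Fin N → ℝ) :
    fromCenter ((fromCenter x).1 + z) = fromCenter (x + z) := by
  rw [fromCenter_eq_iff]
  intro i j
  have := fromCenter_sub_apply x i j
  simp only [Pi.add_apply]
  linarith

/-- Particle `q.2` jumps to particle `q.1`. -/
def synchronize (q : Fin N × Fin N) (x : Fin N → ℝ) : Fin N → ℝ :=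
  Function.update x q.2 (x q.1)

/-- The synchronization jump seen from the center of mass. -/
noncomputable def centeredSynchronize (p : (Fin N × Fin N) × CenteredConfig N) : CenteredConfig N :=
  fromCenter (synchronize p.1 p.2.1)

theorem fromCenter_synchronize (q : Fin N × Fin N) (x : Fin N → ℝ) :
    fromCenter (synchronize q x) = centeredSynchronize (q, fromCenter x) := by
  rw [centeredSynchronize, fromCenter_eq_iff]
  intro i j
  simp only [synchronize, Function.update_apply]
  split_ifs <;> simp [fromCenter_sub_apply]

theorem measurable_synchronize (q : Fin N × Fin N) : Measurable (synchronize q) := by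
  refine measurable_pi_lambda _ fun i => ?_
  simp only [synchronize, Function.update_apply]
  split_ifs <;> fun_prop

@[fun_prop]
theorem measurable_synchronize_uncurry :
    Measurable fun p : (Fin N × Fin N) × (Fin N → ℝ) => synchronize p.1 p.2 :=
  measurable_from_prod_countable_right fun q => measurable_synchronize q

@[fun_prop]
theorem measurable_centeredSynchronize :
    Measurable (centeredSynchronize : (Fin N × Fin N) × CenteredConfig N → CenteredConfig N) :=
  measurable_from_prod_countable_right fun q =>
    measurable_fromCenter.comp ((measurable_synchronize q).comp measurable_subtype_coe)

/-- The transition kernel of `N` Brownian particles, seen from the center of mass. -/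
noncomputable def centeredGaussian (N : ℕ) (σ : ℝ) :
    Kernel (ℝ≥0 × CenteredConfig N) (CenteredConfig N) :=
  ((Kernel.const (ℝ≥0 × CenteredConfig N) (gaussianConfig N 1)) ×ₖ Kernel.id).map
    fun p => fromCenter fun i => p.2.2.1 i + σ * (Real.sqrt p.2.1 * p.1 i)

theorem measurable_centeredGaussian_aux (σ : ℝ) :
    Measurable fun p : (Fin N → ℝ) × ℝ≥0 × CenteredConfig N =>
      fromCenter fun i => p.2.2.1 i + σ * (Real.sqrt p.2.1 * p.1 i) := by
  refine measurable_fromCenter.comp (measurable_pi_lambda _ fun i => ?_)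
  have h : Measurable fun p : (Fin N → ℝ) × ℝ≥0 × CenteredConfig N => p.2.2.1 i :=
    (measurable_pi_apply i).comp (measurable_subtype_coe.comp (by fun_prop))
  exact h.add (by fun_prop)

instance (σ : ℝ) : IsMarkovKernel (centeredGaussian N σ) := by
  unfold centeredGaussian
  exact Kernel.IsMarkovKernel.map _ (measurable_centeredGaussian_aux σ)

theorem lintegral_centeredGaussian (σ : ℝ) {f : CenteredConfig N → ℝ≥0∞} (hf : Measurable f)
    (t : ℝ≥0) (y : CenteredConfig N) :
    ∫⁻ z, f z ∂centeredGaussian N σ (t, y) =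
      ∫⁻ z, f (fromCenter (y.1 + σ • z)) ∂gaussianConfig N t := by
  have hm := measurable_centeredGaussian_aux (N := N) σ
  rw [centeredGaussian, Kernel.lintegral_map _ hm _ hf]
  refine (Kernel.lintegral_prod_id (hf.comp hm) _ _).trans ?_
  rw [← gaussianConfig_map_sqrt_mul t,
    lintegral_map (by fun_prop) (by fun_prop)]
  rfl

theorem isFlow_centeredGaussian (σ : ℝ) : IsFlow (centeredGaussian N σ) where
  zero y := by
    ext A hA
    have hind : Measurable (A.indicator (1 : CenteredConfig N → ℝ≥0∞)) := measurable_one.indicator hA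
    have h0 : gaussianConfig N 0 = Measure.dirac 0 := by
      simp only [gaussianConfig, gaussianReal_zero_var]
      rw [← Measure.infinitePi_eq_pi]
      exact Measure.infinitePi_dirac _
    rw [← lintegral_indicator_one hA, lintegral_centeredGaussian σ hind, h0,
      lintegral_dirac' _ (by fun_prop), smul_zero, add_zero, fromCenter_val,
      Measure.dirac_apply' _ hA]
  add s t y f hf := by
    rw [lintegral_centeredGaussian σ hf, lintegral_gaussianConfig_add s t (by fun_prop),
      lintegral_centeredGaussian σ (f := fun w => ∫⁻ z, f z ∂centeredGaussian N σ (t, w))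
        (hf.lintegral_kernel.comp (by fun_prop))]
    refine lintegral_congr fun z => ?_
    rw [lintegral_centeredGaussian σ hf]
    simp_rw [fromCenter_fromCenter_add, smul_add, add_assoc]

end Particles

/-! ### Doeblin's condition for the centred particle system. -/

section Doeblin

variable {N : ℕ}

/-- The law of a mark: an exponential waiting time, and an independent pair of particles. -/
noncomputable def markLaw (N : ℕ) (δ : ℝ) : Measure (ℝ≥0 × Fin N × Fin N) :=
  (expMeasureNNReal δ).prod (uniformOn {p | p.1 ≠ p.2})

theorem isProbabilityMeasure_uniformOn_pairs (hN : 2 ≤ N) :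
    IsProbabilityMeasure (uniformOn {p : Fin N × Fin N | p.1 ≠ p.2}) :=
  isProbabilityMeasure_uniformOn (Set.toFinite _)
    ⟨(⟨0, by omega⟩, ⟨1, by omega⟩), by simp⟩

theorem isProbabilityMeasure_markLaw (hN : 2 ≤ N) {δ : ℝ} (hδ : 0 < δ) :
    IsProbabilityMeasure (markLaw N δ) := by
  have := isProbabilityMeasure_expMeasureNNReal hδ
  have := isProbabilityMeasure_uniformOn_pairs hN
  unfold markLaw
  infer_instance

/-- The transition function of the particle system seen from its center of mass. -/
noncomputable def centeredTransition (N : ℕ) (σ δ : ℝ) :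
    ℝ≥0 → Kernel (CenteredConfig N) (CenteredConfig N) :=
  jumpTransition (centeredGaussian N σ) centeredSynchronize (markLaw N δ)

theorem isTransitionFunction_centeredTransition (hN : 2 ≤ N) (σ : ℝ) {δ : ℝ} (hδ : 0 < δ) :
    IsTransitionFunction (centeredTransition N σ δ) := by
  have := isProbabilityMeasure_uniformOn_pairs hN
  have := isProbabilityMeasure_markLaw hN hδ
  exact isTransitionFunction_jumpTransition (isFlow_centeredGaussian σ)
    measurable_centeredSynchronize (isMemoryless_expMeasureNNReal_prod hδ _)
    (expMeasureNNReal_prod_le_lt_one hδ _) (expMeasureNNReal_prod_eq_zero hδ _)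

/-- If all jumps go to the particle `a`, then the starting positions, relative to particle `a`, of
the particles that jump are forgotten. -/
theorem lintegral_markedFlow_eq_of_forget (σ : ℝ) {f : CenteredConfig N → ℝ≥0∞} (hf : Measurable f)
    (a : Fin N) {n : ℕ} : ∀ {t : ℝ≥0} {θ : ℕ → ℝ≥0 × Fin N × Fin N} {y y' : CenteredConfig N},
    HasJumps n t θ → (∀ k < n, (θ k).2.1 = a) → (∀ k < n, (θ k).2.2 ≠ a) →
    (∀ i, (∃ k < n, (θ k).2.2 = i) ∨ y.1 i - y.1 a = y'.1 i - y'.1 a) →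
    ∫⁻ z, f z ∂markedFlow (centeredGaussian N σ) centeredSynchronize (t, θ, y) =
      ∫⁻ z, f z ∂markedFlow (centeredGaussian N σ) centeredSynchronize (t, θ, y') := by
  induction n with
  | zero =>
    intro t θ y y' h _ _ hy
    have : y = y' := by
      rw [← fromCenter_val y, ← fromCenter_val y', fromCenter_eq_iff]
      intro i j
      have hi := (hy i).resolve_left (by simp)
      have hj := (hy j).resolve_left (by simp)
      linarith
    rw [this]
  | succ n ih =>
    intro t θ y y' h h1 h2 hy
    obtain ⟨hle, hj⟩ := hasJumps_succ.1 h
    have hm : Measurable fun z => ∫⁻ w, f w ∂markedFlow (centeredGaussian N σ) centeredSynchronize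
        (t - (θ 0).1, seqTail θ, centeredSynchronize ((θ 0).2, z)) :=
      hf.lintegral_kernel.comp (by fun_prop)
    rw [lintegral_markedFlow_of_le _ measurable_centeredSynchronize hf hle,
      lintegral_markedFlow_of_le _ measurable_centeredSynchronize hf hle,
      lintegral_centeredGaussian σ hm, lintegral_centeredGaussian σ hm]
    -- Both starting points are coupled through the same displacement `z`, so differences already
    -- equal stay equal.
    refine lintegral_congr fun z => ?_
    refine ih hj (fun k hk => h1 (k + 1) (by omega)) (fun k hk => h2 (k + 1) (by omega)) fun i => ?_
    have hq1 : (θ 0).2.1 = a := h1 0 (by omega)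
    have hq2 : (θ 0).2.2 ≠ a := h2 0 (by omega)
    simp only [← fromCenter_synchronize, fromCenter_sub_apply]
    by_cases hi : i = (θ 0).2.2
    -- The jumping particle sits on `a` in both copies, at relative position zero.
    · right
      simp [synchronize, hi, hq1, hq2.symm]
    · rcases hy i with ⟨k, hk, hki⟩ | hyi
      · left
        rcases k with _ | k
        · exact absurd hki.symm hi
        · exact ⟨k, by omega, hki⟩
      · right
        simp only [synchronize, Function.update_apply, hi, hq2.symm, if_false, Pi.add_apply]
        linarith

/-- The event that there are `N - 1` jumps up to time `1`, in which the particles other than the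
first one jump to the first one. -/
def collapseEvent (hN : 2 ≤ N) : Set (ℕ → ℝ≥0 × Fin N × Fin N) :=
  {θ | HasJumps (N - 1) 1 θ ∧
    ∀ k (hk : k < N - 1), (θ k).2 = (⟨0, by omega⟩, ⟨k + 1, by omega⟩)}

theorem measurableSet_collapseEvent (hN : 2 ≤ N) : MeasurableSet (collapseEvent hN) := by
  have h : collapseEvent hN = {θ | HasJumps (N - 1) 1 θ} ∩ ⋂ k, ⋂ hk : k < N - 1,
      (fun θ => (θ k).2) ⁻¹' {(⟨0, by omega⟩, ⟨k + 1, by omega⟩)} := by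
    ext
    simp [collapseEvent]
  rw [h]
  refine (measurableSet_hasJumps_right _ _).inter ?_
  refine MeasurableSet.iInter fun k => MeasurableSet.iInter fun hk => ?_
  exact (by fun_prop : Measurable fun θ : ℕ → ℝ≥0 × Fin N × Fin N => (θ k).2)
    (measurableSet_singleton _)

theorem measure_collapseEvent_pos (hN : 2 ≤ N) {δ : ℝ} (hδ : 0 < δ) :
    0 < Measure.infinitePi (fun _ : ℕ => markLaw N δ) (collapseEvent hN) := by
  have := isProbabilityMeasure_markLaw hN hδ
  have := isProbabilityMeasure_expMeasureNNReal hδ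
  have := isProbabilityMeasure_uniformOn_pairs hN
  -- `N - 1` waiting times of at most `1 / N` fit into `[0, 1]`; the next one, of index `N - 1`,
  -- exceeds 1 and excludes further jumps.
  let c : ℝ≥0 := 1 / N
  have hc : 0 < c := by
    have : (0 : ℝ≥0) < N := by exact_mod_cast (by omega : 0 < N)
    positivity
  let t : ℕ → Set (ℝ≥0 × Fin N × Fin N) := fun k =>
    if hk : k < N - 1 then Set.Iic c ×ˢ {(⟨0, by omega⟩, ⟨k + 1, by omega⟩)}
    else Set.Ioi 1 ×ˢ Set.univ
  have ht : ∀ k, MeasurableSet (t k) := fun k => by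
    by_cases hk : k < N - 1
    · simp only [t, hk, dif_pos]
      exact measurableSet_Iic.prod (measurableSet_singleton _)
    · simp only [t, hk, dif_neg, not_false_eq_true]
      exact measurableSet_Ioi.prod .univ
  have hpos : ∀ k, markLaw N δ (t k) ≠ 0 := fun k => by
    by_cases hk : k < N - 1
    · simp only [t, hk, dif_pos, markLaw, Measure.prod_prod]
      refine mul_ne_zero ?_ ?_
      · rw [← measureReal_ne_zero_iff, expMeasureNNReal_real_Iic hδ, sub_ne_zero]
        refine (Real.exp_lt_one_iff.2 ?_).ne'
        have : 0 < δ * c := mul_pos hδ (NNReal.coe_pos.2 hc)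
        linarith
      · rw [Ne, uniformOn_eq_zero_iff (Set.toFinite _)]
        refine Set.Nonempty.ne_empty ⟨_, ?_, rfl⟩
        simp
    · simp only [t, hk, dif_neg, not_false_eq_true, markLaw, Measure.prod_prod, measure_univ,
        mul_one]
      rw [← measureReal_ne_zero_iff, ← Set.compl_Iic, probReal_compl_eq_one_sub measurableSet_Iic,
        expMeasureNNReal_real_Iic hδ]
      simp [(Real.exp_pos _).ne']
  have hbox := Measure.infinitePi_pi (fun _ : ℕ => markLaw N δ) (s := Finset.range N) (t := t)
    fun k _ => ht k
  refine lt_of_lt_of_le ?_ (measure_mono (s := Set.pi (Finset.range N) t) fun θ hθ => ?_)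
  · rw [hbox, pos_iff_ne_zero, Finset.prod_ne_zero_iff]
    exact fun k _ => hpos k
  · have hθ' : ∀ k < N, θ k ∈ t k := fun k hk => hθ k (by simpa using hk)
    have hsmall : ∀ k (hk : k < N - 1), (θ k).1 ≤ c ∧
        (θ k).2 = (⟨0, by omega⟩, ⟨k + 1, by omega⟩) := fun k hk => by
      have := hθ' k (by omega)
      simpa only [t, hk, dif_pos, Set.mem_prod, Set.mem_Iic, Set.mem_singleton_iff] using this
    have hlarge : 1 < (θ (N - 1)).1 := by
      have := hθ' (N - 1) (by omega)
      simpa [t] using this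
    refine ⟨⟨?_, ?_⟩, fun k hk => (hsmall k hk).2⟩
    · calc jumpTime (N - 1) θ ≤ ∑ k ∈ Finset.range (N - 1), c :=
            Finset.sum_le_sum fun k hk => (hsmall k (Finset.mem_range.1 hk)).1
        _ ≤ ∑ k ∈ Finset.range N, c :=
            Finset.sum_le_sum_of_subset (Finset.range_mono (Nat.sub_le _ _))
        _ = 1 := by
            have : (N : ℝ≥0) ≠ 0 := by exact_mod_cast (by omega : N ≠ 0)
            simp [c, this]
    · refine hlarge.trans_le ?_
      exact Finset.single_le_sum (f := fun k => (θ k).1) (fun _ _ => zero_le)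
        (Finset.self_mem_range_succ (N - 1))

/-- The minorizing measure is the contribution of `collapseEvent` to the law at time 1, computed
from an arbitrary `y₀` and normalized; `ε` is the probability of this event. -/
theorem satisfiesDoeblin_centeredTransition (hN : 2 ≤ N) (σ : ℝ) {δ : ℝ} (hδ : 0 < δ) :
    SatisfiesDoeblin (centeredTransition N σ δ) := by
  have := isProbabilityMeasure_markLaw hN hδ
  let y₀ : CenteredConfig N := fromCenter 0
  let L := markedFlow (centeredGaussian N σ) (centeredSynchronize (N := N))
  let ν₀ : Measure (CenteredConfig N) :=
    ((Measure.infinitePi fun _ : ℕ => markLaw N δ).restrict (collapseEvent hN)).bind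
      fun θ => L (1, θ, y₀)
  have hmeas : Measurable fun θ => L (1, θ, y₀) := L.measurable.comp (by fun_prop)
  have hν₀ : ∀ A, MeasurableSet A → ν₀ A = ∫⁻ θ in collapseEvent hN, L (1, θ, y₀) A
      ∂(Measure.infinitePi fun _ : ℕ => markLaw N δ) :=
    fun A hA => Measure.bind_apply hA hmeas.aemeasurable
  have huniv : ν₀ Set.univ =
      Measure.infinitePi (fun _ : ℕ => markLaw N δ) (collapseEvent hN) := by
    rw [hν₀ _ .univ, ← setLIntegral_one]
    exact setLIntegral_congr_fun (measurableSet_collapseEvent hN) fun θ hθ =>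
      markedFlow_univ _ measurable_centeredSynchronize hθ.1 y₀
  have hfin : ν₀ Set.univ ≠ ∞ := by rw [huniv]; exact measure_ne_top _ _
  have hpos : ν₀ Set.univ ≠ 0 := by rw [huniv]; exact (measure_collapseEvent_pos hN hδ).ne'
  refine ⟨1, one_pos, (ν₀ Set.univ).toNNReal, ENNReal.toNNReal_pos hpos hfin,
    (ν₀ Set.univ)⁻¹ • ν₀, ⟨?_⟩, fun y A hA => ?_⟩
  · rw [Measure.smul_apply, smul_eq_mul, ENNReal.inv_mul_cancel hpos hfin]
  · have hind : Measurable (A.indicator (1 : CenteredConfig N → ℝ≥0∞)) := measurable_one.indicator hA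
    rw [ENNReal.coe_toNNReal hfin, Measure.smul_apply, smul_eq_mul, ← mul_assoc,
      ENNReal.mul_inv_cancel hpos hfin, one_mul, hν₀ A hA, ← lintegral_indicator_one hA,
      centeredTransition, lintegral_jumpTransition _ _ hind]
    refine le_trans (le_of_eq ?_) (setLIntegral_le_lintegral (collapseEvent hN) _)
    refine setLIntegral_congr_fun (measurableSet_collapseEvent hN) fun θ hθ => ?_
    rw [← lintegral_indicator_one hA]
    refine lintegral_markedFlow_eq_of_forget σ hind ⟨0, by omega⟩ hθ.1
      (fun k hk => by rw [hθ.2 k hk]) (fun k hk => by rw [hθ.2 k hk]; simp) fun i => ?_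
    by_cases hi : i.1 = 0
    · right
      have : i = ⟨0, by omega⟩ := Fin.ext hi
      simp [this]
    · left
      -- Particle `i ≠ 0` is the one moved by the mark of index `i - 1`.
      have hk : i.1 - 1 < N - 1 := by have := i.2; omega
      refine ⟨i.1 - 1, hk, ?_⟩
      rw [hθ.2 _ hk]
      exact Fin.ext (by simp only; omega)

end Doeblin

/-! ### Counting jumps before and after a given time. -/

section Marks

variable {Q : Type*}

theorem HasJumps.add {n : ℕ} : ∀ {m : ℕ} {s t : ℝ≥0} {θ : ℕ → ℝ≥0 × Q}, HasJumps n s θ →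
    HasJumps m t (shiftMarks n s θ) → HasJumps (n + m) (s + t) θ := by
  induction n with
  | zero =>
    intro m s t θ hs ht
    have hs' := hasJumps_zero.1 hs
    rcases m with _ | m
    · have := hasJumps_zero.1 ht
      exact hasJumps_zero.2 (lt_tsub_iff_left.1 this)
    · obtain ⟨h0, h1⟩ := hasJumps_succ.1 ht
      simp only [shiftMarks, seqCons_zero, seqTail_seqCons] at h0 h1
      obtain ⟨u, hu⟩ := exists_add_of_le hs'.le
      rw [hu, add_tsub_cancel_left] at h0 h1
      rw [zero_add, hasJumps_succ, hu, add_tsub_add_eq_tsub_left]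
      exact ⟨by gcongr, h1⟩
  | succ n ih =>
    intro m s t θ hs ht
    obtain ⟨h0, h1⟩ := hasJumps_succ.1 hs
    rw [Nat.add_right_comm, hasJumps_succ, ← tsub_add_eq_add_tsub h0]
    exact ⟨h0.trans le_self_add, ih h1 ht⟩

theorem HasJumps.exists_shiftMarks {n : ℕ} : ∀ {k : ℕ} {s t : ℝ≥0} {θ : ℕ → ℝ≥0 × Q},
    HasJumps n s θ → HasJumps k (s + t) θ → ∃ m, HasJumps m t (shiftMarks n s θ) := by
  induction n with
  | zero =>
    intro k s t θ hs ht
    have hs' := hasJumps_zero.1 hs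
    rcases k with _ | k
    · exact ⟨0, hasJumps_zero.2 (lt_tsub_iff_left.2 (hasJumps_zero.1 ht))⟩
    · obtain ⟨h0, h1⟩ := hasJumps_succ.1 ht
      refine ⟨k + 1, hasJumps_succ.2 ?_⟩
      obtain ⟨u, hu⟩ := exists_add_of_le hs'.le
      rw [hu] at h0 h1
      rw [add_tsub_add_eq_tsub_left] at h1
      simp only [shiftMarks, seqCons_zero, seqTail_seqCons, hu, add_tsub_cancel_left]
      exact ⟨(add_le_add_iff_left s).1 h0, h1⟩
  | succ n ih =>
    intro k s t θ hs ht
    obtain ⟨h0, h1⟩ := hasJumps_succ.1 hs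
    rcases k with _ | k
    · exact absurd (hasJumps_zero.1 ht) (not_lt.2 (h0.trans le_self_add))
    · have h2 := (hasJumps_succ.1 ht).2
      rw [← tsub_add_eq_add_tsub h0] at h2
      exact ih h1 h2

/-- The number of jumps up to time `t`. -/
noncomputable def numJumps (t : ℝ≥0) (θ : ℕ → ℝ≥0 × Q) : ℕ := sInf {n | HasJumps n t θ}

theorem HasJumps.numJumps_eq {n : ℕ} {t : ℝ≥0} {θ : ℕ → ℝ≥0 × Q} (h : HasJumps n t θ) :
    numJumps t θ = n :=
  (HasJumps.eq (Nat.sInf_mem (s := {n | HasJumps n t θ}) ⟨n, h⟩) h)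

variable [MeasurableSpace Q]

@[fun_prop]
theorem measurable_numJumps :
    Measurable fun p : ℝ≥0 × (ℕ → ℝ≥0 × Q) => numJumps p.1 p.2 := by
  refine measurable_to_countable' fun n => ?_
  -- When no count is valid, `sInf ∅ = 0`; the second set accounts for this default.
  have h : (fun p : ℝ≥0 × (ℕ → ℝ≥0 × Q) => numJumps p.1 p.2) ⁻¹' {n} =
      {p | HasJumps n p.1 p.2} ∪ ({p | n = 0} ∩ ⋂ m, {p | HasJumps m p.1 p.2}ᶜ) := by
    ext p
    simp only [Set.mem_preimage, Set.mem_singleton_iff, Set.mem_union, Set.mem_inter_iff,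
      Set.mem_iInter, Set.mem_compl_iff, Set.mem_ofPred_eq]
    constructor
    · intro hn
      by_cases hex : ∃ m, HasJumps m p.1 p.2
      · obtain ⟨m, hm⟩ := hex
        left
        rwa [← hn, hm.numJumps_eq]
      · push Not at hex
        refine Or.inr ⟨?_, hex⟩
        have he : {n | HasJumps n p.1 p.2} = ∅ := Set.eq_empty_of_forall_notMem hex
        rw [← hn, numJumps, he, Nat.sInf_empty]
    · rintro (hn | ⟨h0, hn⟩)
      · exact hn.numJumps_eq
      · have he : {n | HasJumps n p.1 p.2} = ∅ := Set.eq_empty_of_forall_notMem hn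
        rw [h0, numJumps, he, Nat.sInf_empty]
  rw [h]
  exact (measurableSet_hasJumps n).union ((MeasurableSet.const _).inter
    (MeasurableSet.iInter fun m => (measurableSet_hasJumps m).compl))

end Marks

/-! ### The particle system as a functional of marks, path and initial configuration. -/

section Paths

variable {N : ℕ}

/-- The value of a continuous path `w` at time `t`, expressed through the values at rational times
before `t` so as to be measurable in `(w, t)`. -/
noncomputable def pathEval (w : ℝ≥0 → Fin N → ℝ) (t : ℝ≥0) : Fin N → ℝ := fun i =>
  limsup (fun k : ℕ => w (⌊((k : ℝ≥0) + 1) * t⌋₊ / ((k : ℝ≥0) + 1)) i) atTop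

theorem floor_mul_div_le (k : ℕ) (t : ℝ≥0) :
    (⌊((k : ℝ≥0) + 1) * t⌋₊ : ℝ≥0) / ((k : ℝ≥0) + 1) ≤ t := by
  rw [div_le_iff₀ (by positivity), mul_comm t]
  exact Nat.floor_le zero_le

theorem tendsto_floor_mul_div (t : ℝ≥0) :
    Tendsto (fun k : ℕ => (⌊((k : ℝ≥0) + 1) * t⌋₊ : ℝ≥0) / ((k : ℝ≥0) + 1)) atTop (𝓝 t) := by
  have h1 : Tendsto (fun k : ℕ => t - 1 / ((k : ℝ≥0) + 1)) atTop (𝓝 t) := by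
    have : Tendsto (fun k : ℕ => 1 / ((k : ℝ≥0) + 1)) atTop (𝓝 0) :=
      tendsto_one_div_add_atTop_nhds_zero_nat
    simpa using (tendsto_const_nhds (x := t)).sub this
  refine tendsto_of_tendsto_of_tendsto_of_le_of_le h1 tendsto_const_nhds (fun k => ?_)
    fun k => floor_mul_div_le k t
  rw [tsub_le_iff_right, ← add_div, le_div_iff₀ (by positivity), mul_comm t]
  exact (Nat.lt_floor_add_one _).le

theorem pathEval_eq {w : ℝ≥0 → Fin N → ℝ} (hw : ∀ i, Continuous fun t => w t i) (t : ℝ≥0) :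
    pathEval w t = w t :=
  funext fun i => (((hw i).tendsto t).comp (tendsto_floor_mul_div t)).limsup_eq

@[fun_prop]
-- Plain evaluation is in general not jointly measurable for the product σ-algebra on all paths; the
-- rational grid involves only countably many coordinates.
theorem measurable_pathEval :
    Measurable fun p : (ℝ≥0 → Fin N → ℝ) × ℝ≥0 => pathEval p.1 p.2 := by
  refine measurable_pi_lambda _ fun i => Measurable.limsup fun k => ?_
  have h1 : Measurable fun p : (ℝ≥0 → Fin N → ℝ) × ℕ => p.1 (p.2 / ((k : ℝ≥0) + 1)) i :=
    measurable_from_prod_countable_left fun n =>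
      (measurable_pi_apply i).comp (measurable_pi_apply ((n : ℝ≥0) / ((k : ℝ≥0) + 1)))
  exact h1.comp (f := fun p : (ℝ≥0 → Fin N → ℝ) × ℝ≥0 => (p.1, ⌊((k : ℝ≥0) + 1) * p.2⌋₊))
    (by fun_prop)

/-- The information on the path up to time `r` and on the initial configuration. -/
@[reducible]
def pastSigma (N : ℕ) (r : ℝ≥0) : MeasurableSpace ((ℝ≥0 → Fin N → ℝ) × (Fin N → ℝ)) :=
  MeasurableSpace.comap (fun p => ((fun s : Set.Iic r => p.1 s), p.2)) inferInstance

theorem pastSigma_mono {r s : ℝ≥0} (h : r ≤ s) : pastSigma N r ≤ pastSigma N s := by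
  have : (fun p : (ℝ≥0 → Fin N → ℝ) × (Fin N → ℝ) => ((fun u : Set.Iic r => p.1 u), p.2)) =
      (fun q : (Set.Iic s → Fin N → ℝ) × (Fin N → ℝ) =>
        ((fun u : Set.Iic r => q.1 ⟨u, u.2.trans h⟩), q.2)) ∘
      fun p => ((fun u : Set.Iic s => p.1 u), p.2) := rfl
  rw [pastSigma, this, ← MeasurableSpace.comap_comp]
  exact MeasurableSpace.comap_mono (Measurable.comap_le (by fun_prop))

/-- The grid approximates `t` from below, so no value after `t` is consulted. -/
theorem measurable_pathEval_pastSigma {r t : ℝ≥0} (h : t ≤ r) :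
    Measurable[pastSigma N r] fun p => pathEval p.1 t := by
  have : (fun p : (ℝ≥0 → Fin N → ℝ) × (Fin N → ℝ) => pathEval p.1 t) =
      (fun q : (Set.Iic r → Fin N → ℝ) × (Fin N → ℝ) => fun i => limsup (fun k : ℕ =>
        q.1 ⟨⌊((k : ℝ≥0) + 1) * t⌋₊ / ((k : ℝ≥0) + 1), (floor_mul_div_le k t).trans h⟩ i) atTop) ∘
      fun p => ((fun u : Set.Iic r => p.1 u), p.2) := rfl
  rw [this]
  refine Measurable.comp ?_ (comap_measurable _)
  exact measurable_pi_lambda _ fun i => Measurable.limsup fun k => by fun_prop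

theorem measurable_snd_pastSigma (r : ℝ≥0) :
    Measurable[pastSigma N r] (Prod.snd : (ℝ≥0 → Fin N → ℝ) × (Fin N → ℝ) → Fin N → ℝ) :=
  Measurable.comp (g := (Prod.snd : (Set.Iic r → Fin N → ℝ) × (Fin N → ℝ) → Fin N → ℝ))
    measurable_snd (comap_measurable _)

/-- The configuration at time `r + t` if the configuration at time `r` is `x`, the particles follow
the paths `σ • w`, and there are `n` jumps at the times and with the pairs given by the marks. -/
noncomputable def pathFlowAux (σ : ℝ) : ℕ → ℝ≥0 → ℝ≥0 → (ℕ → ℝ≥0 × Fin N × Fin N) →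
    (Fin N → ℝ) → (ℝ≥0 → Fin N → ℝ) → Fin N → ℝ
  | 0, r, t, _, x, w => x + σ • (pathEval w (r + t) - pathEval w r)
  | n + 1, r, t, θ, x, w => pathFlowAux σ n (r + (θ 0).1) (t - (θ 0).1) (seqTail θ)
      (synchronize (θ 0).2 (x + σ • (pathEval w (r + (θ 0).1) - pathEval w r))) w

/-- The configuration at time `r + t` if the configuration at time `r` is `x`, the particles follow
the paths `σ • w`, and the jumps are given by the marks. -/
noncomputable def pathFlow (σ : ℝ) (r t : ℝ≥0) (θ : ℕ → ℝ≥0 × Fin N × Fin N)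
    (x : Fin N → ℝ) (w : ℝ≥0 → Fin N → ℝ) : Fin N → ℝ :=
  pathFlowAux σ (numJumps t θ) r t θ x w

theorem HasJumps.pathFlow_eq {n : ℕ} {t : ℝ≥0} {θ : ℕ → ℝ≥0 × Fin N × Fin N}
    (h : HasJumps n t θ) (σ : ℝ) (r : ℝ≥0) (x : Fin N → ℝ) (w : ℝ≥0 → Fin N → ℝ) :
    pathFlow σ r t θ x w = pathFlowAux σ n r t θ x w := by
  rw [pathFlow, h.numJumps_eq]

theorem measurable_pathFlowAux (σ : ℝ) (n : ℕ) : Measurable fun p : ℝ≥0 × ℝ≥0 ×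
    (ℕ → ℝ≥0 × Fin N × Fin N) × (Fin N → ℝ) × (ℝ≥0 → Fin N → ℝ) =>
      pathFlowAux σ n p.1 p.2.1 p.2.2.1 p.2.2.2.1 p.2.2.2.2 := by
  induction n with
  | zero =>
    simp only [pathFlowAux]
    have h1 : Measurable fun p : ℝ≥0 × ℝ≥0 × (ℕ → ℝ≥0 × Fin N × Fin N) × (Fin N → ℝ) ×
        (ℝ≥0 → Fin N → ℝ) => pathEval p.2.2.2.2 (p.1 + p.2.1) :=
      measurable_pathEval.comp (f := fun p : ℝ≥0 × ℝ≥0 × (ℕ → ℝ≥0 × Fin N × Fin N) × (Fin N → ℝ) ×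
        (ℝ≥0 → Fin N → ℝ) => (p.2.2.2.2, p.1 + p.2.1)) (by fun_prop)
    have h2 : Measurable fun p : ℝ≥0 × ℝ≥0 × (ℕ → ℝ≥0 × Fin N × Fin N) × (Fin N → ℝ) ×
        (ℝ≥0 → Fin N → ℝ) => pathEval p.2.2.2.2 p.1 :=
      measurable_pathEval.comp (f := fun p : ℝ≥0 × ℝ≥0 × (ℕ → ℝ≥0 × Fin N × Fin N) × (Fin N → ℝ) ×
        (ℝ≥0 → Fin N → ℝ) => (p.2.2.2.2, p.1)) (by fun_prop)
    exact Measurable.add (by fun_prop) ((h1.sub h2).const_smul σ)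
  | succ n ih =>
    simp only [pathFlowAux]
    have h1 : Measurable fun p : ℝ≥0 × ℝ≥0 × (ℕ → ℝ≥0 × Fin N × Fin N) × (Fin N → ℝ) ×
        (ℝ≥0 → Fin N → ℝ) => pathEval p.2.2.2.2 (p.1 + (p.2.2.1 0).1) :=
      measurable_pathEval.comp (f := fun p : ℝ≥0 × ℝ≥0 × (ℕ → ℝ≥0 × Fin N × Fin N) × (Fin N → ℝ) ×
        (ℝ≥0 → Fin N → ℝ) => (p.2.2.2.2, p.1 + (p.2.2.1 0).1)) (by fun_prop)
    have h2 : Measurable fun p : ℝ≥0 × ℝ≥0 × (ℕ → ℝ≥0 × Fin N × Fin N) × (Fin N → ℝ) ×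
        (ℝ≥0 → Fin N → ℝ) => pathEval p.2.2.2.2 p.1 :=
      measurable_pathEval.comp (f := fun p : ℝ≥0 × ℝ≥0 × (ℕ → ℝ≥0 × Fin N × Fin N) × (Fin N → ℝ) ×
        (ℝ≥0 → Fin N → ℝ) => (p.2.2.2.2, p.1)) (by fun_prop)
    have h3 : Measurable fun p : ℝ≥0 × ℝ≥0 × (ℕ → ℝ≥0 × Fin N × Fin N) × (Fin N → ℝ) ×
        (ℝ≥0 → Fin N → ℝ) => p.2.2.2.1 + σ • (pathEval p.2.2.2.2 (p.1 + (p.2.2.1 0).1) -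
          pathEval p.2.2.2.2 p.1) :=
      Measurable.add (by fun_prop) ((h1.sub h2).const_smul σ)
    have h4 := measurable_synchronize_uncurry.comp (Measurable.prodMk (by fun_prop :
      Measurable fun p : ℝ≥0 × ℝ≥0 × (ℕ → ℝ≥0 × Fin N × Fin N) × (Fin N → ℝ) ×
        (ℝ≥0 → Fin N → ℝ) => (p.2.2.1 0).2) h3)
    exact ih.comp (Measurable.prodMk (by fun_prop) (Measurable.prodMk (by fun_prop)
      (Measurable.prodMk (by fun_prop) (Measurable.prodMk h4 (by fun_prop)))))

@[fun_prop]
theorem measurable_pathFlow (σ : ℝ) : Measurable fun p : ℝ≥0 × ℝ≥0 ×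
    (ℕ → ℝ≥0 × Fin N × Fin N) × (Fin N → ℝ) × (ℝ≥0 → Fin N → ℝ) =>
      pathFlow σ p.1 p.2.1 p.2.2.1 p.2.2.2.1 p.2.2.2.2 := by
  have h : Measurable fun q : ℕ × (ℝ≥0 × ℝ≥0 × (ℕ → ℝ≥0 × Fin N × Fin N) × (Fin N → ℝ) ×
      (ℝ≥0 → Fin N → ℝ)) => pathFlowAux σ q.1 q.2.1 q.2.2.1 q.2.2.2.1 q.2.2.2.2.1 q.2.2.2.2.2 :=
    measurable_from_prod_countable_right fun n => measurable_pathFlowAux σ n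
  refine h.comp (Measurable.prodMk ?_ measurable_id)
  exact measurable_numJumps.comp (f := fun p : ℝ≥0 × ℝ≥0 × (ℕ → ℝ≥0 × Fin N × Fin N) ×
    (Fin N → ℝ) × (ℝ≥0 → Fin N → ℝ) => (p.2.1, p.2.2.1)) (by fun_prop)

/-- With frozen marks the jump times are deterministic, so the flow is adapted. -/
theorem measurable_pathFlowAux_pastSigma (σ : ℝ) {n : ℕ} : ∀ {r t R : ℝ≥0}
    {θ : ℕ → ℝ≥0 × Fin N × Fin N} {Y : (ℝ≥0 → Fin N → ℝ) × (Fin N → ℝ) → Fin N → ℝ},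
    HasJumps n t θ → r + t ≤ R → Measurable[pastSigma N R] Y →
    Measurable[pastSigma N R] fun p => pathFlowAux σ n r t θ (Y p) p.1 := by
  induction n with
  | zero =>
    intro r t R θ Y _ hR hY
    exact hY.add (((measurable_pathEval_pastSigma hR).sub
      (measurable_pathEval_pastSigma (le_self_add.trans hR))).const_smul σ)
  | succ n ih =>
    intro r t R θ Y h hR hY
    obtain ⟨h0, h1⟩ := hasJumps_succ.1 h
    refine ih h1 (by rwa [add_assoc, add_tsub_cancel_of_le h0]) ((measurable_synchronize _).comp ?_)
    exact hY.add (((measurable_pathEval_pastSigma (le_trans (by gcongr) hR)).sub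
      (measurable_pathEval_pastSigma (le_self_add.trans hR))).const_smul σ)

/-- The pathwise counterpart of `lintegral_markedFlow_add`. The path is read at absolute times,
hence the restart at `r + s`. -/
theorem pathFlowAux_add (σ : ℝ) {n : ℕ} : ∀ {m : ℕ} {r s t : ℝ≥0}
    {θ : ℕ → ℝ≥0 × Fin N × Fin N} {x : Fin N → ℝ} (w : ℝ≥0 → Fin N → ℝ), HasJumps n s θ →
    HasJumps m t (shiftMarks n s θ) → pathFlowAux σ (n + m) r (s + t) θ x w =
      pathFlowAux σ m (r + s) t (shiftMarks n s θ) (pathFlowAux σ n r s θ x w) w := by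
  induction n with
  | zero =>
    intro m r s t θ x w hs ht
    have hs' := hasJumps_zero.1 hs
    rcases m with _ | m
    · simp only [pathFlowAux, add_assoc, ← smul_add]
      congr 2
      abel
    · obtain ⟨u, hu⟩ := exists_add_of_le hs'.le
      rw [zero_add]
      simp only [pathFlowAux, shiftMarks, seqCons_zero, seqTail_seqCons, hu, add_tsub_cancel_left,
        add_tsub_add_eq_tsub_left, add_assoc, ← smul_add]
      congr 4
      abel
  | succ n ih =>
    intro m r s t θ x w hs ht
    obtain ⟨h0, h1⟩ := hasJumps_succ.1 hs
    rw [Nat.add_right_comm]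
    simp only [pathFlowAux]
    rw [← tsub_add_eq_add_tsub h0, ih w h1 ht, add_assoc, add_tsub_cancel_of_le h0]
    rfl

/-- Needed at all `t ≤ s`, because the Markov property is tested against the whole trajectory up to
`s`. -/
theorem exists_pathFlowAux_congr (σ : ℝ) {n : ℕ} : ∀ {s t : ℝ≥0}
    {θ θ' : ℕ → ℝ≥0 × Fin N × Fin N}, HasJumps n s θ → HasJumps n s θ' → (∀ k < n, θ k = θ' k) →
    t ≤ s → ∃ m, HasJumps m t θ ∧ HasJumps m t θ' ∧ ∀ r x w,
      pathFlowAux σ m r t θ x w = pathFlowAux σ m r t θ' x w := by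
  induction n with
  | zero =>
    intro s t θ θ' h h' _ ht
    exact ⟨0, hasJumps_zero.2 (ht.trans_lt (hasJumps_zero.1 h)),
      hasJumps_zero.2 (ht.trans_lt (hasJumps_zero.1 h')), fun _ _ _ => rfl⟩
  | succ n ih =>
    intro s t θ θ' h h' hk ht
    obtain ⟨h0, h1⟩ := hasJumps_succ.1 h
    obtain ⟨h0', h1'⟩ := hasJumps_succ.1 h'
    have h00 := hk 0 (Nat.succ_pos n)
    rw [← h00] at h0' h1'
    rcases lt_or_ge t (θ 0).1 with hlt | hge
    · exact ⟨0, hasJumps_zero.2 hlt, hasJumps_zero.2 (h00 ▸ hlt), fun _ _ _ => rfl⟩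
    · obtain ⟨m, hm, hm', heq⟩ := ih h1 h1' (fun k hk' => hk (k + 1) (by omega))
        (tsub_le_tsub_right ht _)
      refine ⟨m + 1, hasJumps_succ.2 ⟨hge, hm⟩, hasJumps_succ.2 ⟨h00 ▸ hge, h00 ▸ hm'⟩,
        fun r x w => ?_⟩
      simp only [pathFlowAux, ← h00, heq]

theorem pathFlow_congr (σ : ℝ) {n : ℕ} {s t : ℝ≥0} {θ θ' : ℕ → ℝ≥0 × Fin N × Fin N}
    (h : HasJumps n s θ) (h' : HasJumps n s θ') (hk : ∀ k < n, θ k = θ' k) (ht : t ≤ s) (r : ℝ≥0)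
    (x : Fin N → ℝ) (w : ℝ≥0 → Fin N → ℝ) : pathFlow σ r t θ x w = pathFlow σ r t θ' x w := by
  obtain ⟨m, hm, hm', heq⟩ := exists_pathFlowAux_congr σ h h' hk ht
  rw [hm.pathFlow_eq, hm'.pathFlow_eq, heq]

theorem measurable_pathFlow_pastSigma (σ : ℝ) {r t R : ℝ≥0} {θ : ℕ → ℝ≥0 × Fin N × Fin N}
    {Y : (ℝ≥0 → Fin N → ℝ) × (Fin N → ℝ) → Fin N → ℝ} (hex : ∃ n, HasJumps n t θ) (hR : r + t ≤ R)
    (hY : Measurable[pastSigma N R] Y) :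
    Measurable[pastSigma N R] fun p => pathFlow σ r t θ (Y p) p.1 := by
  obtain ⟨n, hn⟩ := hex
  simp_rw [hn.pathFlow_eq]
  exact measurable_pathFlowAux_pastSigma σ hn hR hY

theorem pathFlow_add (σ : ℝ) {n m : ℕ} {r s t : ℝ≥0} {θ : ℕ → ℝ≥0 × Fin N × Fin N}
    (x : Fin N → ℝ) (w : ℝ≥0 → Fin N → ℝ) (hs : HasJumps n s θ)
    (ht : HasJumps m t (shiftMarks n s θ)) : pathFlow σ r (s + t) θ x w =
      pathFlowAux σ m (r + s) t (shiftMarks n s θ) (pathFlow σ r s θ x w) w := by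
  rw [(hs.add ht).pathFlow_eq, hs.pathFlow_eq, pathFlowAux_add σ w hs ht]

end Paths

/-! ### The Markov property under the Brownian path law. -/

section BrownianPaths

variable {N : ℕ}

/-- The law of a Brownian path and of an independent initial configuration: the increments after
time `r` are Gaussian, and independent of the path up to time `r` and of the initial
configuration. -/
def IsBrownianPathLaw (Λ : Measure ((ℝ≥0 → Fin N → ℝ) × (Fin N → ℝ))) : Prop :=
  ∀ (r t : ℝ≥0) (F : ((Set.Iic r → Fin N → ℝ) × (Fin N → ℝ)) × (Fin N → ℝ) → ℝ≥0∞), Measurable F →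
    ∫⁻ p, F (((fun s : Set.Iic r => p.1 s), p.2), pathEval p.1 (r + t) - pathEval p.1 r) ∂Λ =
      ∫⁻ p, ∫⁻ z, F (((fun s : Set.Iic r => p.1 s), p.2), z) ∂gaussianConfig N t ∂Λ

variable {Λ : Measure ((ℝ≥0 → Fin N → ℝ) × (Fin N → ℝ))}

theorem IsBrownianPathLaw.lintegral_mul (hΛ : IsBrownianPathLaw Λ) {r : ℝ≥0} (t : ℝ≥0)
    {g : (ℝ≥0 → Fin N → ℝ) × (Fin N → ℝ) → ℝ≥0∞} (hg : Measurable[pastSigma N r] g)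
    {Y : (ℝ≥0 → Fin N → ℝ) × (Fin N → ℝ) → Fin N → ℝ} (hY : Measurable[pastSigma N r] Y)
    {h : (Fin N → ℝ) × (Fin N → ℝ) → ℝ≥0∞} (hh : Measurable h) :
    ∫⁻ p, g p * h (Y p, pathEval p.1 (r + t) - pathEval p.1 r) ∂Λ =
      ∫⁻ p, g p * ∫⁻ z, h (Y p, z) ∂gaussianConfig N t ∂Λ := by
  -- Doob–Dynkin: past-measurable quantities factor through the restricted path and the initial
  -- configuration.
  obtain ⟨k, hk, hgk⟩ := (hg.prodMk hY).exists_eq_measurable_comp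
  have hg' : ∀ p, g p = (k ((fun s : Set.Iic r => p.1 s), p.2)).1 := fun p =>
    congrArg Prod.fst (congrFun hgk p)
  have hY' : ∀ p, Y p = (k ((fun s : Set.Iic r => p.1 s), p.2)).2 := fun p =>
    congrArg Prod.snd (congrFun hgk p)
  have := hΛ r t (fun q => (k q.1).1 * h ((k q.1).2, q.2)) (by fun_prop)
  simp_rw [hg', hY']
  rw [this]
  refine lintegral_congr fun p => ?_
  dsimp only
  exact lintegral_const_mul _ (hh.comp measurable_prodMk_left)

/-- The Markov property of the particle system with given jump times and pairs. -/
theorem IsBrownianPathLaw.lintegral_pathFlowAux (hΛ : IsBrownianPathLaw Λ) (σ : ℝ)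
    {f : CenteredConfig N → ℝ≥0∞} (hf : Measurable f) {n : ℕ} : ∀ {r t : ℝ≥0}
    {θ : ℕ → ℝ≥0 × Fin N × Fin N}, HasJumps n t θ →
    ∀ {g : (ℝ≥0 → Fin N → ℝ) × (Fin N → ℝ) → ℝ≥0∞}, Measurable[pastSigma N r] g →
    ∀ {Y : (ℝ≥0 → Fin N → ℝ) × (Fin N → ℝ) → Fin N → ℝ}, Measurable[pastSigma N r] Y →
    ∫⁻ p, g p * f (fromCenter (pathFlowAux σ n r t θ (Y p) p.1)) ∂Λ =
      ∫⁻ p, g p * ∫⁻ z, f z ∂markedFlow (centeredGaussian N σ) centeredSynchronize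
        (t, θ, fromCenter (Y p)) ∂Λ := by
  induction n with
  | zero =>
    intro r t θ h g hg Y hY
    simp only [pathFlowAux]
    rw [hΛ.lintegral_mul t hg hY (h := fun q => f (fromCenter (q.1 + σ • q.2))) (by fun_prop)]
    refine lintegral_congr fun p => ?_
    rw [lintegral_markedFlow_of_lt _ _ (hasJumps_zero.1 h), lintegral_centeredGaussian σ hf]
    simp_rw [fromCenter_fromCenter_add]
  | succ n ih =>
    intro r t θ h g hg Y hY
    obtain ⟨h0, h1⟩ := hasJumps_succ.1 h
    have hle : r ≤ r + (θ 0).1 := le_self_add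
    have hm : Measurable fun z => ∫⁻ w, f w ∂markedFlow (centeredGaussian N σ) centeredSynchronize
        (t - (θ 0).1, seqTail θ, centeredSynchronize ((θ 0).2, z)) :=
      hf.lintegral_kernel.comp (by fun_prop)
    have hY' : Measurable[pastSigma N (r + (θ 0).1)] fun p => synchronize (θ 0).2
        (Y p + σ • (pathEval p.1 (r + (θ 0).1) - pathEval p.1 r)) :=
      (measurable_synchronize _).comp ((hY.mono (pastSigma_mono hle) le_rfl).add
        (((measurable_pathEval_pastSigma le_rfl).sub
          (measurable_pathEval_pastSigma hle)).const_smul σ))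
    simp only [pathFlowAux]
    -- The stretch after the first jump is integrated out before the first one: the weight and the
    -- state just after the jump belong to the past of the jump time.
    rw [ih h1 (hg.mono (pastSigma_mono hle) le_rfl) hY']
    simp_rw [fromCenter_synchronize]
    rw [hΛ.lintegral_mul (θ 0).1 hg hY (h := fun q => ∫⁻ w, f w
      ∂markedFlow (centeredGaussian N σ) centeredSynchronize (t - (θ 0).1, seqTail θ,
        centeredSynchronize ((θ 0).2, fromCenter (q.1 + σ • q.2)))) (hm.comp (by fun_prop))]
    refine lintegral_congr fun p => ?_
    rw [lintegral_markedFlow_of_le _ measurable_centeredSynchronize hf h0,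
      lintegral_centeredGaussian σ hm]
    simp_rw [fromCenter_fromCenter_add]

/-- The Markov property of the particle system, for the law of its ingredients. -/
theorem IsBrownianPathLaw.lintegral_pathFlow_add (hΛ : IsBrownianPathLaw Λ)
    [IsProbabilityMeasure Λ] (hN : 2 ≤ N) (σ : ℝ) {δ : ℝ} (hδ : 0 < δ) (s t : ℝ≥0)
    {D : Set (Set.Iic s → CenteredConfig N)} (hD : MeasurableSet D)
    {f : CenteredConfig N → ℝ≥0∞} (hf : Measurable f) :
    ∫⁻ θ, ∫⁻ p, D.indicator 1 (fun r : Set.Iic s => fromCenter (pathFlow σ 0 r θ p.2 p.1)) *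
        f (fromCenter (pathFlow σ 0 (s + t) θ p.2 p.1)) ∂Λ
        ∂(Measure.infinitePi fun _ : ℕ => markLaw N δ) =
      ∫⁻ θ, ∫⁻ p, D.indicator 1 (fun r : Set.Iic s => fromCenter (pathFlow σ 0 r θ p.2 p.1)) *
        ∫⁻ z, f z ∂centeredTransition N σ δ t (fromCenter (pathFlow σ 0 s θ p.2 p.1)) ∂Λ
        ∂(Measure.infinitePi fun _ : ℕ => markLaw N δ) := by
  have := isProbabilityMeasure_uniformOn_pairs hN
  have := isProbabilityMeasure_markLaw hN hδ
  have hex := ae_exists_hasJumps (ρ := markLaw N δ) (expMeasureNNReal_prod_le_lt_one hδ _)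
  have hind : Measurable (D.indicator (1 : (Set.Iic s → CenteredConfig N) → ℝ≥0∞)) :=
    measurable_one.indicator hD
  have hpf : ∀ r : ℝ≥0, Measurable fun q : (ℕ → ℝ≥0 × Fin N × Fin N) ×
      (ℝ≥0 → Fin N → ℝ) × (Fin N → ℝ) => fromCenter (pathFlow σ 0 r q.1 q.2.2 q.2.1) := fun r =>
    measurable_fromCenter.comp ((measurable_pathFlow σ).comp (f := fun q : (ℕ → ℝ≥0 × Fin N × Fin N)
      × (ℝ≥0 → Fin N → ℝ) × (Fin N → ℝ) => (0, r, q.1, q.2.2, q.2.1)) (by fun_prop))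
  have hDm : Measurable fun q : (ℕ → ℝ≥0 × Fin N × Fin N) × (ℝ≥0 → Fin N → ℝ) × (Fin N → ℝ) =>
      D.indicator (1 : (Set.Iic s → CenteredConfig N) → ℝ≥0∞)
        fun r : Set.Iic s => fromCenter (pathFlow σ 0 r q.1 q.2.2 q.2.1) :=
    hind.comp (measurable_pi_lambda _ fun r => hpf r)
  have hL : Measurable fun q => ∫⁻ z, f z ∂markedFlow (centeredGaussian N σ) centeredSynchronize q :=
    hf.lintegral_kernel
  obtain ⟨g, hg⟩ : ∃ g : (ℕ → ℝ≥0 × Fin N × Fin N) → (ℝ≥0 → Fin N → ℝ) × (Fin N → ℝ) → ℝ≥0∞,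
      ∀ θ p, D.indicator 1 (fun r : Set.Iic s => fromCenter (pathFlow σ 0 r θ p.2 p.1)) = g θ p :=
    ⟨_, fun _ _ => rfl⟩
  obtain ⟨X, hX⟩ : ∃ X : (ℕ → ℝ≥0 × Fin N × Fin N) → (ℝ≥0 → Fin N → ℝ) × (Fin N → ℝ) →
      CenteredConfig N, ∀ θ p, fromCenter (pathFlow σ 0 s θ p.2 p.1) = X θ p := ⟨_, fun _ _ => rfl⟩
  have hgm : Measurable fun q : (ℕ → ℝ≥0 × Fin N × Fin N) × (ℝ≥0 → Fin N → ℝ) × (Fin N → ℝ) =>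
      g q.1 q.2 := by
    simp_rw [← hg]
    exact hDm
  have hXm : Measurable fun q : (ℕ → ℝ≥0 × Fin N × Fin N) × (ℝ≥0 → Fin N → ℝ) × (Fin N → ℝ) =>
      X q.1 q.2 := by
    simp_rw [← hX]
    exact hpf s
  simp_rw [hg, hX]
  have hHm : Measurable fun q : ((ℕ → ℝ≥0 × Fin N × Fin N) × (ℕ → ℝ≥0 × Fin N × Fin N)) ×
      (ℝ≥0 → Fin N → ℝ) × (Fin N → ℝ) => g q.1.1 q.2 *
        ∫⁻ z, f z ∂markedFlow (centeredGaussian N σ) centeredSynchronize (t, q.1.2, X q.1.1 q.2) := by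
    have e : Measurable fun q : ((ℕ → ℝ≥0 × Fin N × Fin N) × (ℕ → ℝ≥0 × Fin N × Fin N)) ×
      (ℝ≥0 → Fin N → ℝ) × (Fin N → ℝ) => (q.1.1, q.2) := by fun_prop
    exact (hgm.comp e).mul (hL.comp (measurable_const.prodMk
      ((measurable_snd.comp measurable_fst).prodMk (hXm.comp e))))
  -- `H θ η` takes the past from `θ` and runs the future with fresh marks `η`; averaging over `η`
  -- then yields `centeredTransition`.
  refine (lintegral_shiftMarks (ρ := markLaw N δ) (s := s)
    (isMemoryless_expMeasureNNReal_prod hδ _) (hex.mono fun θ h => h s)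
    (H := fun θ η => ∫⁻ p, g θ p * ∫⁻ z, f z ∂markedFlow (centeredGaussian N σ)
        centeredSynchronize (t, η, X θ p) ∂Λ) hHm.lintegral_prod_right' ?_ ?_).trans ?_
  · intro n θ θ' h h' hk
    funext η
    refine lintegral_congr fun p => ?_
    rw [← hX, ← hX, ← hg, ← hg, pathFlow_congr σ h h' hk le_rfl]
    congr 2
    funext r
    rw [pathFlow_congr σ h h' hk r.2]
  · filter_upwards [hex] with θ hθ n hn
    obtain ⟨k, hk⟩ := hθ (s + t)
    obtain ⟨m, hm⟩ := hn.exists_shiftMarks hk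
    have hflow : ∀ p : (ℝ≥0 → Fin N → ℝ) × (Fin N → ℝ), pathFlow σ 0 (s + t) θ p.2 p.1 =
        pathFlowAux σ m s t (shiftMarks n s θ) (pathFlow σ 0 s θ p.2 p.1) p.1 := fun p => by
      rw [pathFlow_add σ _ _ hn hm, zero_add]
    simp_rw [hflow, ← hX]
    refine hΛ.lintegral_pathFlowAux σ hf hm ?_ ?_
    · rw [← funext (hg θ)]
      refine hind.comp (@measurable_pi_lambda _ _ _ (pastSigma N s) _ _ fun r =>
        measurable_fromCenter.comp ?_)
      exact measurable_pathFlow_pastSigma σ (hθ r) (by rw [zero_add]; exact r.2)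
        (measurable_snd_pastSigma s)
    · exact measurable_pathFlow_pastSigma σ (hθ s) (zero_add s).le (measurable_snd_pastSigma s)
  · refine lintegral_congr fun θ => ?_
    have hsw : Measurable fun q : (ℕ → ℝ≥0 × Fin N × Fin N) × (ℝ≥0 → Fin N → ℝ) × (Fin N → ℝ) =>
        g θ q.2 * ∫⁻ z, f z ∂markedFlow (centeredGaussian N σ) centeredSynchronize
          (t, q.1, X θ q.2) :=
      hHm.comp (f := fun q : (ℕ → ℝ≥0 × Fin N × Fin N) ×
        (ℝ≥0 → Fin N → ℝ) × (Fin N → ℝ) => ((θ, q.1), q.2)) (by fun_prop)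
    refine (lintegral_lintegral_swap (f := fun η p => g θ p * ∫⁻ z, f z ∂markedFlow
      (centeredGaussian N σ) centeredSynchronize (t, η, X θ p)) hsw.aemeasurable).trans ?_
    refine lintegral_congr fun p => ?_
    rw [centeredTransition, lintegral_jumpTransition _ _ hf]
    exact lintegral_const_mul _ (hL.comp (f := fun η => (t, η, X θ p)) (by fun_prop))

theorem pathEval_ae_eq {Ω : Type*} [MeasurableSpace Ω] {P : Measure Ω}
    {B : ℝ≥0 → Ω → Fin N → ℝ} (hB : IsStandardBrownian B P) :
    ∀ᵐ ω ∂P, ∀ t, pathEval (fun t => B t ω) t = B t ω := by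
  filter_upwards [ae_all_iff.2 fun k => (hB.coord k).cont] with ω hω t
  exact pathEval_eq hω t

/-- In each coordinate the increment is independent of the past. Independence of coordinates makes
the pairs (increment, past) a product, which is rearranged into a pair of products. -/
theorem IsStandardBrownian.map_increment {Ω : Type*} [MeasurableSpace Ω] {P : Measure Ω}
    [IsProbabilityMeasure P] {B : ℝ≥0 → Ω → Fin N → ℝ} (hB : IsStandardBrownian B P) (r t : ℝ≥0) :
    P.map (fun ω => (B (r + t) ω - B r ω, fun s : Set.Iic r => B s ω)) =
      (gaussianConfig N t).prod (P.map fun ω (s : Set.Iic r) => B s ω) := by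
  have hBm := hB.measurable
  have hBk : ∀ t k, Measurable fun ω => B t ω k := fun t k => (measurable_pi_apply k).comp (hBm t)
  let I : Ω → Fin N → ℝ := fun ω => B (r + t) ω - B r ω
  let A : Ω → Fin N → Set.Iic r → ℝ := fun ω k s => B s ω k
  have hI : ∀ k, Measurable fun ω => I ω k := fun k => (hBk _ k).sub (hBk _ k)
  have hA : ∀ k, Measurable fun ω => A ω k := fun k => measurable_pi_lambda _ fun s => hBk s k
  have h1 : P.map (fun ω k => (I ω k, A ω k)) =
      Measure.pi fun k => (gaussianReal 0 t).prod (P.map fun ω => A ω k) := by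
    have hind : iIndepFun (fun k ω => (I ω k, A ω k)) P :=
      hB.indep.comp (fun k (w : ℝ≥0 → ℝ) => (w (r + t) - w r, fun s : Set.Iic r => w s))
        fun k => by fun_prop
    rw [hind.map_fun_eq_pi_map fun k => ((hI k).prodMk (hA k)).aemeasurable]
    congr 1
    funext k
    have hk := (hB.coord k).toIsPreBrownianReal
    have hk1 : IndepFun (fun ω => I ω k) (fun ω => A ω k) P :=
      (hk.indepFun_shift r).comp (φ := fun w : ℝ≥0 → ℝ => w t) (ψ := id) (by fun_prop) measurable_id
    rw [hk1.map_prod_eq_prod_map_map (hI k).aemeasurable (hA k).aemeasurable]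
    congr 1
    exact ((hk.shift r).hasLaw_eval t).map_eq
  have hprob : ∀ k, IsProbabilityMeasure (P.map fun ω => A ω k) := fun k =>
    Measure.isProbabilityMeasure_map (hA k).aemeasurable
  have hIm : Measurable I := measurable_pi_lambda _ hI
  have hAm : Measurable A := measurable_pi_lambda _ hA
  have h2 : P.map (fun ω => (I ω, A ω)) =
      (gaussianConfig N t).prod (Measure.pi fun k => P.map fun ω => A ω k) := by
    have := (measurePreserving_arrowProdEquivProdArrow ℝ (Set.Iic r → ℝ) (Fin N)
      (fun _ => gaussianReal 0 t) (fun k => P.map fun ω => A ω k)).map_eq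
    rw [← h1, Measure.map_map (MeasurableEquiv.measurable _)
      (measurable_pi_lambda _ fun k => (hI k).prodMk (hA k))] at this
    exact this
  have h3 : P.map A = Measure.pi fun k => P.map fun ω => A ω k := by
    have := congrArg (fun m => m.map Prod.snd) h2
    simpa [Measure.map_map measurable_snd (hIm.prodMk hAm), Function.comp_def] using this
  let φ : (Fin N → Set.Iic r → ℝ) → Set.Iic r → Fin N → ℝ := fun a s k => a k s
  have hφ : Measurable φ := by fun_prop
  have h4 : P.map (fun ω (s : Set.Iic r) => B s ω) = (P.map A).map φ := by
    rw [Measure.map_map hφ hAm]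
    rfl
  have hpA : IsProbabilityMeasure (P.map A) := Measure.isProbabilityMeasure_map hAm.aemeasurable
  rw [h4, ← Measure.map_id (μ := gaussianConfig N t), Measure.map_prod_map _ _ measurable_id hφ, h3,
    ← h2, Measure.map_map (measurable_id.prodMap hφ) (hIm.prodMk hAm)]
  rfl

theorem IsStandardBrownian.isBrownianPathLaw {Ω : Type*} [MeasurableSpace Ω] {P : Measure Ω}
    [IsProbabilityMeasure P] {B : ℝ≥0 → Ω → Fin N → ℝ} (hB : IsStandardBrownian B P)
    {x₀ : Ω → Fin N → ℝ} (hx : Measurable x₀) (hind : IndepFun (fun ω t => B t ω) x₀ P) :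
    IsBrownianPathLaw (P.map fun ω => ((fun t => B t ω), x₀ ω)) := by
  intro r t F hF
  have hBm := hB.measurable
  have hη : Measurable fun ω => ((fun t => B t ω), x₀ ω) :=
    (measurable_pi_lambda _ hBm).prodMk hx
  have hAm : Measurable fun ω (s : Set.Iic r) => B s ω := measurable_pi_lambda _ fun s => hBm s
  have hIm : Measurable fun ω => B (r + t) ω - B r ω := (hBm _).sub (hBm _)
  have hpA : IsProbabilityMeasure (P.map fun ω (s : Set.Iic r) => B s ω) :=
    Measure.isProbabilityMeasure_map hAm.aemeasurable
  have hpx : IsProbabilityMeasure (P.map x₀) := Measure.isProbabilityMeasure_map hx.aemeasurable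
  -- Increment, past and initial configuration are jointly independent.
  have hj1 : P.map (fun ω => ((B (r + t) ω - B r ω, fun s : Set.Iic r => B s ω), x₀ ω)) =
      ((gaussianConfig N t).prod (P.map fun ω (s : Set.Iic r) => B s ω)).prod (P.map x₀) := by
    rw [← hB.map_increment r t]
    exact (hind.comp (φ := fun w : ℝ≥0 → Fin N → ℝ => (w (r + t) - w r, fun s : Set.Iic r => w s))
      (ψ := id) (by fun_prop) measurable_id).map_prod_eq_prod_map_map
      (hIm.prodMk hAm).aemeasurable hx.aemeasurable
  have hj2 : P.map (fun ω => ((fun s : Set.Iic r => B s ω), x₀ ω)) =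
      (P.map fun ω (s : Set.Iic r) => B s ω).prod (P.map x₀) :=
    (hind.comp (φ := fun (w : ℝ≥0 → Fin N → ℝ) (s : Set.Iic r) => w s)
      (ψ := id) (by fun_prop) measurable_id).map_prod_eq_prod_map_map
      hAm.aemeasurable hx.aemeasurable
  have hev : ∀ u, Measurable fun p : (ℝ≥0 → Fin N → ℝ) × (Fin N → ℝ) => pathEval p.1 u := fun u =>
    measurable_pathEval.comp (f := fun p : (ℝ≥0 → Fin N → ℝ) × (Fin N → ℝ) => (p.1, u))
      (by fun_prop)
  have hinner : Measurable fun a => ∫⁻ z, F (a, z) ∂gaussianConfig N t := hF.lintegral_prod_right'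
  have hF1 : Measurable fun p : (ℝ≥0 → Fin N → ℝ) × (Fin N → ℝ) =>
      F (((fun s : Set.Iic r => p.1 s), p.2), pathEval p.1 (r + t) - pathEval p.1 r) :=
    hF.comp (Measurable.prodMk (by fun_prop) ((hev _).sub (hev _)))
  have hF2 : Measurable fun p : (ℝ≥0 → Fin N → ℝ) × (Fin N → ℝ) =>
      ∫⁻ z, F (((fun s : Set.Iic r => p.1 s), p.2), z) ∂gaussianConfig N t :=
    hinner.comp (by fun_prop)
  rw [lintegral_map hF1 hη, lintegral_map hF2 hη]
  calc ∫⁻ ω, F (((fun s : Set.Iic r => B s ω), x₀ ω),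
          pathEval (fun t => B t ω) (r + t) - pathEval (fun t => B t ω) r) ∂P
      = ∫⁻ ω, F (((fun s : Set.Iic r => B s ω), x₀ ω), B (r + t) ω - B r ω) ∂P := by
        refine lintegral_congr_ae ?_
        filter_upwards [pathEval_ae_eq hB] with ω hω
        rw [hω, hω]
    _ = ∫⁻ q, F ((q.1.2, q.2), q.1.1) ∂(P.map fun ω =>
          ((B (r + t) ω - B r ω, fun s : Set.Iic r => B s ω), x₀ ω)) := by
        rw [lintegral_map (by fun_prop) ((hIm.prodMk hAm).prodMk hx)]
    _ = ∫⁻ q, ∫⁻ z, F (q, z) ∂gaussianConfig N t ∂(P.map fun ω =>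
          ((fun s : Set.Iic r => B s ω), x₀ ω)) := by
        rw [hj1, hj2, lintegral_prod_symm _ (by fun_prop), lintegral_prod_symm _ (by fun_prop)]
        refine lintegral_congr fun x => ?_
        rw [lintegral_prod_symm _ (by fun_prop)]
    _ = _ := lintegral_map hinner (hAm.prodMk hx)

end BrownianPaths

/-! ### The joint law of waiting times and pairs. -/

section MarksLaw

/-- Tested on boxes: the section over `u` has as measure a product of functions of single
coordinates `u i`, and independence factors its integral. -/
theorem map_zip_infinitePi {X Y : Type*} [MeasurableSpace X] [MeasurableSpace Y] (μ : Measure X)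
    (ν : Measure Y) [IsProbabilityMeasure μ] [IsProbabilityMeasure ν] :
    ((Measure.infinitePi fun _ : ℕ => μ).prod (Measure.infinitePi fun _ : ℕ => ν)).map
      (fun p n => (p.1 n, p.2 n)) = Measure.infinitePi fun _ : ℕ => μ.prod ν := by
  refine Measure.eq_infinitePi _ fun s t ht => ?_
  have hm : Measurable fun (p : (ℕ → X) × (ℕ → Y)) n => (p.1 n, p.2 n) := by fun_prop
  have hst : MeasurableSet (Set.pi (s : Set ℕ) t) := MeasurableSet.pi s.countable_toSet fun i _ => ht i
  rw [Measure.map_apply hm hst, Measure.prod_apply (hm hst)]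
  have h1 : ∀ u : ℕ → X, Measure.infinitePi (fun _ : ℕ => ν) (Prod.mk u ⁻¹'
      ((fun (p : (ℕ → X) × (ℕ → Y)) n => (p.1 n, p.2 n)) ⁻¹' Set.pi (s : Set ℕ) t)) =
      ∏ i ∈ s, ν (Prod.mk (u i) ⁻¹' t i) := fun u => by
    rw [← Measure.infinitePi_pi (fun _ : ℕ => ν) fun i _ => measurable_prodMk_left (ht i)]
    rfl
  simp_rw [h1]
  rw [lintegral_prod_eq_prod_lintegral_of_indepFun (μ := Measure.infinitePi fun _ : ℕ => μ) s
    (fun i u => ν (Prod.mk (u i) ⁻¹' t i))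
    (iIndepFun_infinitePi (X := fun i x => ν (Prod.mk x ⁻¹' t i))
      fun i => measurable_measure_prodMk_left (ht i))
    fun i => (measurable_measure_prodMk_left (ht i)).comp (measurable_pi_apply i)]
  refine Finset.prod_congr rfl fun i _ => ?_
  rw [Measure.prod_apply (ht i)]
  exact (measurePreserving_eval_infinitePi (fun _ : ℕ => μ) i).lintegral_comp
    (measurable_measure_prodMk_left (ht i))

variable {N : ℕ} {Ω : Type*} [MeasurableSpace Ω] {P : Measure Ω}
  {σ δ : ℝ} {B : ℝ≥0 → Ω → Fin N → ℝ} {τ : ℕ → Ω → ℝ≥0} {q : ℕ → Ω → Fin N × Fin N}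
  {x : ℝ≥0 → Ω → Fin N → ℝ}

/-- The marks of the synchronization jumps: the waiting times, and the pairs of particles. -/
noncomputable def jumpMarks (τ : ℕ → Ω → ℝ≥0) (q : ℕ → Ω → Fin N × Fin N) (ω : Ω) :
    ℕ → ℝ≥0 × Fin N × Fin N := fun n => (τ (n + 1) ω - τ n ω, q n ω)

theorem IsPoissonFlow.map_waitingTimes (hτ : IsPoissonFlow δ τ P) :
    P.map (fun ω n => τ (n + 1) ω - τ n ω) =
      Measure.infinitePi fun _ : ℕ => expMeasureNNReal δ := by
  have he : ∀ n ω, τ (n + 1) ω - τ n ω = Real.toNNReal ((τ (n + 1) ω : ℝ) - τ n ω) :=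
    fun n ω => NNReal.sub_def
  have hm : ∀ n, Measurable fun ω => τ (n + 1) ω - τ n ω := fun n =>
    (hτ.measurable _).sub (hτ.measurable _)
  have hind : iIndepFun (fun n ω => τ (n + 1) ω - τ n ω) P := by
    simp_rw [he]
    exact hτ.indep.comp (fun _ => Real.toNNReal) fun _ => measurable_real_toNNReal
  rw [hind.map_fun_eq_infinitePi_map hm]
  congr 1
  funext n
  rw [expMeasureNNReal, ← (hτ.law n).map_eq, AEMeasurable.map_map_of_aemeasurable
    measurable_real_toNNReal.aemeasurable (hτ.law n).aemeasurable]
  congr 1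

theorem IsUniformPairs.map_eq (hq : IsUniformPairs q P) : P.map (fun ω n => q n ω) =
    Measure.infinitePi fun _ : ℕ => uniformOn {p : Fin N × Fin N | p.1 ≠ p.2} := by
  rw [hq.indep.map_fun_eq_infinitePi_map hq.measurable]
  congr 1
  funext n
  exact (hq.law n).map_eq

theorem IsSynchronizedSystem.measurable_jumpMarks (h : IsSynchronizedSystem σ δ B τ q x P) :
    Measurable (jumpMarks τ q) :=
  measurable_pi_lambda _ fun n => ((h.poisson.measurable _).sub (h.poisson.measurable _)).prodMk
    (h.pairs.measurable n)

theorem IsSynchronizedSystem.measurable_paths (h : IsSynchronizedSystem σ δ B τ q x P) :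
    Measurable fun ω => ((fun t => B t ω), x 0 ω) :=
  (measurable_pi_lambda _ h.brownian.measurable).prodMk (h.measurable 0)

theorem IsSynchronizedSystem.indepFun_marks_paths (h : IsSynchronizedSystem σ δ B τ q x P) :
    IndepFun (jumpMarks τ q) (fun ω => ((fun t => B t ω), x 0 ω)) P := by
  have hle : ∀ i, ![MeasurableSpace.comap (fun ω t => B t ω) inferInstance,
      MeasurableSpace.comap (fun ω n => τ n ω) inferInstance,
      MeasurableSpace.comap (x 0) inferInstance,
      MeasurableSpace.comap (fun ω n => q n ω) inferInstance] i ≤ ‹MeasurableSpace Ω› := by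
    intro i
    fin_cases i
    · exact (measurable_pi_lambda _ h.brownian.measurable).comap_le
    · exact (measurable_pi_lambda _ h.poisson.measurable).comap_le
    · exact (h.measurable 0).comap_le
    · exact (measurable_pi_lambda _ h.pairs.measurable).comap_le
  -- Epochs and pairs (indices 1, 3) are grouped against Brownian motion and initial configuration
  -- (0, 2).
  have hd := indep_iSup_of_disjoint hle h.indep (S := {1, 3}) (T := {0, 2})
    (by simp [Set.disjoint_left])
  rw [iSup_pair, iSup_pair] at hd
  have h1 : IndepFun (fun ω => ((fun n => τ n ω), fun n => q n ω))
      (fun ω => ((fun t => B t ω), x 0 ω)) P := by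
    have e1 : MeasurableSpace.comap (fun ω => ((fun n => τ n ω), fun n => q n ω)) inferInstance =
        MeasurableSpace.comap (fun ω n => τ n ω) inferInstance ⊔
          MeasurableSpace.comap (fun ω n => q n ω) inferInstance := MeasurableSpace.comap_prodMk _ _
    have e2 : MeasurableSpace.comap (fun ω => ((fun t => B t ω), x 0 ω)) inferInstance =
        MeasurableSpace.comap (fun ω t => B t ω) inferInstance ⊔
          MeasurableSpace.comap (x 0) inferInstance := MeasurableSpace.comap_prodMk _ _
    rw [IndepFun_iff_Indep, e1, e2]
    exact hd
  exact h1.comp (φ := fun p : (ℕ → ℝ≥0) × (ℕ → Fin N × Fin N) => fun n =>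
    (p.1 (n + 1) - p.1 n, p.2 n)) (ψ := id) (by fun_prop) measurable_id

theorem IsSynchronizedSystem.map_jumpMarks [IsProbabilityMeasure P]
    (h : IsSynchronizedSystem σ δ B τ q x P) (hN : 2 ≤ N) (hδ : 0 < δ) :
    P.map (jumpMarks τ q) = Measure.infinitePi fun _ : ℕ => markLaw N δ := by
  have := isProbabilityMeasure_expMeasureNNReal hδ
  have := isProbabilityMeasure_uniformOn_pairs hN
  have hind : IndepFun (fun ω n => τ n ω) (fun ω n => q n ω) P :=
    h.indep.indep (i := 1) (j := 3) (by decide)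
  have hind' : IndepFun (fun ω n => τ (n + 1) ω - τ n ω) (fun ω n => q n ω) P :=
    hind.comp (φ := fun (v : ℕ → ℝ≥0) n => v (n + 1) - v n) (ψ := id) (by fun_prop) measurable_id
  have hm1 : Measurable fun ω n => τ (n + 1) ω - τ n ω := measurable_pi_lambda _ fun n =>
    (h.poisson.measurable _).sub (h.poisson.measurable _)
  have hm2 : Measurable fun ω n => q n ω := measurable_pi_lambda _ h.pairs.measurable
  have hj := hind'.map_prod_eq_prod_map_map hm1.aemeasurable hm2.aemeasurable
  rw [h.poisson.map_waitingTimes, h.pairs.map_eq] at hj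
  unfold markLaw
  rw [← map_zip_infinitePi, ← hj, Measure.map_map (by fun_prop) (hm1.prodMk hm2)]
  rfl

end MarksLaw

/-! ### Representation of a given system, and transfer of the Markov property. -/

section Link

variable {N : ℕ} {Ω : Type*} [MeasurableSpace Ω] {P : Measure Ω} [IsProbabilityMeasure P]
  {σ δ : ℝ} {B : ℝ≥0 → Ω → Fin N → ℝ} {τ : ℕ → Ω → ℝ≥0} {q : ℕ → Ω → Fin N × Fin N}
  {x : ℝ≥0 → Ω → Fin N → ℝ}

/-- The particle system is a functional of the marks, the Brownian path and the initial
configuration. -/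
theorem IsSynchronizedSystem.ae_eq_pathFlow (h : IsSynchronizedSystem σ δ B τ q x P) (hN : 2 ≤ N)
    (hδ : 0 < δ) : ∀ᵐ ω ∂P, ∀ t, x t ω = pathFlow σ 0 t (jumpMarks τ q ω) (x 0 ω)
      fun t => B t ω := by
  have := isProbabilityMeasure_uniformOn_pairs hN
  have := isProbabilityMeasure_markLaw hN hδ
  have hex : ∀ᵐ ω ∂P, ∀ s, ∃ n, HasJumps n s (jumpMarks τ q ω) := by
    have := ae_exists_hasJumps (ρ := markLaw N δ) (expMeasureNNReal_prod_le_lt_one hδ _)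
    rw [← h.map_jumpMarks hN hδ] at this
    exact ae_of_ae_map h.measurable_jumpMarks.aemeasurable this
  filter_upwards [hex, h.poisson.zero, h.poisson.strictMono, h.free, h.jump, h.stay,
    pathEval_ae_eq h.brownian, ae_all_iff.2 fun k => (h.brownian.coord k).cont]
    with ω hex h0 hmono hfree hjump hstay heval hcont t
  have hτ : ∀ k, τ k ω + (τ (k + 1) ω - τ k ω) = τ (k + 1) ω := fun k =>
    add_tsub_cancel_of_le (hmono.monotone (Nat.le_succ k))
  have hfree' : ∀ k s, τ k ω ≤ s → s < τ (k + 1) ω →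
      x s ω = x (τ k ω) ω + σ • (B s ω - B (τ k ω) ω) := fun k s h1 h2 => by
    funext i
    have := hfree k s ⟨h1, h2⟩ i
    simp only [Pi.add_apply, Pi.smul_apply, Pi.sub_apply, smul_eq_mul]
    linarith
  have hne : ∀ k, (𝓝[<] (τ (k + 1) ω)).NeBot := fun k =>
    nhdsLT_neBot_of_exists_lt ⟨τ k ω, hmono (Nat.lt_succ_self k)⟩
  -- Free motion and continuity of `B` give the left limit at an epoch; uniqueness of limits then
  -- turns the jump conditions into the equation `hsync`.
  have hlim : ∀ k i, Tendsto (fun s => x s ω i) (𝓝[<] (τ (k + 1) ω))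
      (𝓝 ((x (τ k ω) ω + σ • (B (τ (k + 1) ω) ω - B (τ k ω) ω)) i)) := by
    intro k i
    have hc : Tendsto (fun s => (x (τ k ω) ω + σ • (B s ω - B (τ k ω) ω)) i)
        (𝓝[<] (τ (k + 1) ω)) (𝓝 ((x (τ k ω) ω + σ • (B (τ (k + 1) ω) ω - B (τ k ω) ω)) i)) := by
      simp only [Pi.add_apply, Pi.smul_apply, Pi.sub_apply, smul_eq_mul]
      have := hcont i
      exact ((by fun_prop : Continuous fun s => x (τ k ω) ω i + σ * (B s ω i -
        B (τ k ω) ω i)).tendsto _).mono_left nhdsWithin_le_nhds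
    refine hc.congr' ?_
    have hmem : Set.Ioo (τ k ω) (τ (k + 1) ω) ∈ 𝓝[<] (τ (k + 1) ω) :=
      Ioo_mem_nhdsLT (hmono (Nat.lt_succ_self k))
    filter_upwards [hmem] with s hs
    rw [hfree' k s hs.1.le hs.2]
  have hsync : ∀ k, x (τ (k + 1) ω) ω =
      synchronize (q k ω) (x (τ k ω) ω + σ • (B (τ (k + 1) ω) ω - B (τ k ω) ω)) := by
    intro k
    have := hne k
    funext i
    by_cases hi : i = (q k ω).2
    · rw [hi, synchronize, Function.update_self]
      exact tendsto_nhds_unique (hjump k) (hlim k _)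
    · rw [synchronize, Function.update_of_ne hi]
      exact tendsto_nhds_unique (hstay k i hi) (hlim k i)
  -- Generalized over the epoch `k` of the restart, since the induction on `n` moves from one epoch
  -- to the next.
  have key : ∀ n k s, HasJumps n s (fun j => jumpMarks τ q ω (k + j)) →
      x (τ k ω + s) ω = pathFlowAux σ n (τ k ω) s (fun j => jumpMarks τ q ω (k + j))
        (x (τ k ω) ω) fun t => B t ω := by
    intro n
    induction n with
    | zero =>
      intro k s hs
      have hs' := hasJumps_zero.1 hs
      simp only [pathFlowAux, heval]
      refine hfree' k _ le_self_add ?_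
      rw [← hτ k]
      exact (add_lt_add_iff_left _).2 hs'
    | succ n ih =>
      intro k s hs
      obtain ⟨hle, hs'⟩ := hasJumps_succ.1 hs
      have e : seqTail (fun j => jumpMarks τ q ω (k + j)) =
          fun j => jumpMarks τ q ω (k + 1 + j) := by
        funext j
        rw [seqTail_apply, add_assoc, add_comm 1 j]
      have e0 : (jumpMarks τ q ω (k + 0)) = (τ (k + 1) ω - τ k ω, q k ω) := rfl
      simp only [e0] at hle hs'
      rw [e] at hs'
      simp only [pathFlowAux, heval, e0, hτ, e]
      have e1 : τ k ω + s = τ (k + 1) ω + (s - (τ (k + 1) ω - τ k ω)) := by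
        conv_lhs => rw [← add_tsub_cancel_of_le hle, ← add_assoc, hτ]
      rw [← hsync, ← ih (k + 1) _ hs', e1]
  obtain ⟨n, hn⟩ := hex t
  have hk := key n 0 t (by simpa using hn)
  simp only [h0, zero_add] at hk
  rw [hn.pathFlow_eq, hk]

theorem IsSynchronizedSystem.map_marks_paths (h : IsSynchronizedSystem σ δ B τ q x P) (hN : 2 ≤ N)
    (hδ : 0 < δ) : P.map (fun ω => (jumpMarks τ q ω, ((fun t => B t ω), x 0 ω))) =
      (Measure.infinitePi fun _ : ℕ => markLaw N δ).prod
        (P.map fun ω => ((fun t => B t ω), x 0 ω)) := by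
  rw [← h.map_jumpMarks hN hδ]
  exact h.indepFun_marks_paths.map_prod_eq_prod_map_map h.measurable_jumpMarks.aemeasurable
    h.measurable_paths.aemeasurable

theorem IsSynchronizedSystem.lintegral_add (h : IsSynchronizedSystem σ δ B τ q x P) (hN : 2 ≤ N)
    (hδ : 0 < δ) (s t : ℝ≥0) {D : Set (Set.Iic s → CenteredConfig N)} (hD : MeasurableSet D)
    {f : CenteredConfig N → ℝ≥0∞} (hf : Measurable f) :
    ∫⁻ ω, D.indicator 1 (fun r : Set.Iic s => fromCenter (x r ω)) *
        f (fromCenter (x (s + t) ω)) ∂P =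
      ∫⁻ ω, D.indicator 1 (fun r : Set.Iic s => fromCenter (x r ω)) *
        ∫⁻ z, f z ∂centeredTransition N σ δ t (fromCenter (x s ω)) ∂P := by
  have hprob : IsProbabilityMeasure (P.map fun ω => ((fun t => B t ω), x 0 ω)) :=
    Measure.isProbabilityMeasure_map h.measurable_paths.aemeasurable
  have := isProbabilityMeasure_markLaw hN hδ
  have hΛ : IsBrownianPathLaw (P.map fun ω => ((fun t => B t ω), x 0 ω)) :=
    h.brownian.isBrownianPathLaw (h.measurable 0) (h.indep.indep (i := 0) (j := 2) (by decide))
  have hpf : ∀ r : ℝ≥0, Measurable fun p : (ℕ → ℝ≥0 × Fin N × Fin N) ×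
      (ℝ≥0 → Fin N → ℝ) × (Fin N → ℝ) => fromCenter (pathFlow σ 0 r p.1 p.2.2 p.2.1) := fun r =>
    measurable_fromCenter.comp ((measurable_pathFlow σ).comp (f := fun p : (ℕ → ℝ≥0 × Fin N × Fin N)
      × (ℝ≥0 → Fin N → ℝ) × (Fin N → ℝ) => (0, r, p.1, p.2.2, p.2.1)) (by fun_prop))
  have hDm : Measurable fun p : (ℕ → ℝ≥0 × Fin N × Fin N) × (ℝ≥0 → Fin N → ℝ) × (Fin N → ℝ) =>
      D.indicator (1 : (Set.Iic s → CenteredConfig N) → ℝ≥0∞)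
        fun r : Set.Iic s => fromCenter (pathFlow σ 0 r p.1 p.2.2 p.2.1) :=
    (measurable_one.indicator hD).comp (measurable_pi_lambda _ fun r => hpf r)
  -- Expectations over `Ω` become integrals over marks and paths separately, by representation and
  -- independence.
  have transfer : ∀ (u : ℝ≥0) (k : CenteredConfig N → ℝ≥0∞), Measurable k →
      ∫⁻ ω, D.indicator 1 (fun r : Set.Iic s => fromCenter (x r ω)) * k (fromCenter (x u ω)) ∂P =
      ∫⁻ θ, ∫⁻ p, D.indicator 1 (fun r : Set.Iic s => fromCenter (pathFlow σ 0 r θ p.2 p.1)) *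
        k (fromCenter (pathFlow σ 0 u θ p.2 p.1)) ∂(P.map fun ω => ((fun t => B t ω), x 0 ω))
        ∂(Measure.infinitePi fun _ : ℕ => markLaw N δ) := by
    intro u k hk
    have hm : Measurable fun p : (ℕ → ℝ≥0 × Fin N × Fin N) × (ℝ≥0 → Fin N → ℝ) × (Fin N → ℝ) =>
        D.indicator (1 : (Set.Iic s → CenteredConfig N) → ℝ≥0∞)
          (fun r : Set.Iic s => fromCenter (pathFlow σ 0 r p.1 p.2.2 p.2.1)) *
        k (fromCenter (pathFlow σ 0 u p.1 p.2.2 p.2.1)) := hDm.mul (hk.comp (hpf u))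
    have hae : (fun ω => D.indicator (1 : (Set.Iic s → CenteredConfig N) → ℝ≥0∞)
          (fun r : Set.Iic s => fromCenter (x r ω)) * k (fromCenter (x u ω))) =ᵐ[P]
        fun ω => D.indicator (1 : (Set.Iic s → CenteredConfig N) → ℝ≥0∞)
          (fun r : Set.Iic s => fromCenter (pathFlow σ 0 r (jumpMarks τ q ω) (x 0 ω)
            fun t => B t ω)) *
          k (fromCenter (pathFlow σ 0 u (jumpMarks τ q ω) (x 0 ω) fun t => B t ω)) := by
      filter_upwards [h.ae_eq_pathFlow hN hδ] with ω hω
      simp_rw [← hω]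
    rw [lintegral_congr_ae hae]
    obtain ⟨Φ, hΦ⟩ : ∃ Φ : (ℕ → ℝ≥0 × Fin N × Fin N) →
        (ℝ≥0 → Fin N → ℝ) × (Fin N → ℝ) → ℝ≥0∞, ∀ θ p,
        D.indicator 1 (fun r : Set.Iic s => fromCenter (pathFlow σ 0 r θ p.2 p.1)) *
          k (fromCenter (pathFlow σ 0 u θ p.2 p.1)) = Φ θ p := ⟨_, fun _ _ => rfl⟩
    simp_rw [hΦ] at hm ⊢
    have hΦ' : ∀ ω, _ = Φ (jumpMarks τ q ω) ((fun t => B t ω), x 0 ω) := fun ω => hΦ _ _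
    simp_rw [hΦ']
    rw [lintegral_lintegral hm.aemeasurable, ← h.map_marks_paths hN hδ,
      lintegral_map hm (h.measurable_jumpMarks.prodMk h.measurable_paths)]
  rw [transfer (s + t) f hf, hΛ.lintegral_pathFlow_add hN σ hδ s t hD hf,
    transfer s (fun y => ∫⁻ z, f z ∂centeredTransition N σ δ t y) hf.lintegral_kernel]

end Link

/-! ### The Markov property from integral identities. -/

section Markov

theorem history_eq_comap {E Ω : Type*} [MeasurableSpace E] (X : ℝ≥0 → Ω → E) (s : ℝ≥0) :
    history X s = MeasurableSpace.comap (fun ω (r : Set.Iic s) => X r ω) inferInstance := by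
  unfold history
  simp only [MeasurableSpace.pi, MeasurableSpace.comap_iSup, MeasurableSpace.comap_comp,
    iSup_subtype]
  rfl

theorem history_le {E Ω : Type*} [MeasurableSpace E] [m : MeasurableSpace Ω] {X : ℝ≥0 → Ω → E}
    (hX : ∀ t, Measurable (X t)) (s : ℝ≥0) : history X s ≤ m :=
  iSup₂_le fun r _ => (hX r).comap_le

theorem measurable_history {E Ω : Type*} [MeasurableSpace E] (X : ℝ≥0 → Ω → E) (s : ℝ≥0) :
    Measurable[history X s] (X s) :=
  measurable_iff_comap_le.2 (le_iSup₂_of_le s Set.self_mem_Iic le_rfl)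

/-- By `history_eq_comap` every event of the history says that the restricted trajectory lies in
some `D`, so the hypothesis is the defining identity of conditional expectation and no generating
class is required. -/
theorem IsMarkovProcess.of_lintegral {E Ω : Type*} [MeasurableSpace E] [MeasurableSpace Ω]
    {X : ℝ≥0 → Ω → E} {κ : ℝ≥0 → Kernel E E} {P : Measure Ω} [IsProbabilityMeasure P]
    (hκ : ∀ t, IsMarkovKernel (κ t)) (hX : ∀ t, Measurable (X t))
    (h : ∀ (s t : ℝ≥0) (D : Set (Set.Iic s → E)), MeasurableSet D → ∀ A : Set E, MeasurableSet A →
      ∫⁻ ω, D.indicator 1 (fun r : Set.Iic s => X r ω) * A.indicator 1 (X (s + t) ω) ∂P =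
        ∫⁻ ω, D.indicator 1 (fun r : Set.Iic s => X r ω) *
          ∫⁻ z, A.indicator 1 z ∂κ t (X s ω) ∂P) :
    IsMarkovProcess X κ P where
  measurable := hX
  markov s t A hA := by
    have hκt := hκ t
    have hm : Measurable fun y => (κ t y).real A := ((κ t).measurable_coe hA).ennreal_toReal
    have hmX : Measurable[history X s] fun ω => (κ t (X s ω)).real A :=
      hm.comp (measurable_history X s)
    have hint : Integrable (fun ω => (κ t (X s ω)).real A) P :=
      Integrable.of_bound (hm.comp (hX s)).aestronglyMeasurable 1
        (ae_of_all _ fun ω => by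
          rw [Real.norm_of_nonneg measureReal_nonneg]
          exact measureReal_le_one)
    have hA' : MeasurableSet (X (s + t) ⁻¹' A) := hX _ hA
    symm
    refine ae_eq_condExp_of_forall_setIntegral_eq (history_le hX s)
      ((integrable_const (1 : ℝ)).indicator hA') (fun _ _ _ => hint.integrableOn) ?_
      hmX.stronglyMeasurable.aestronglyMeasurable
    intro C hC _
    rw [history_eq_comap] at hC
    obtain ⟨D, hD, rfl⟩ := hC
    have hXs : Measurable fun ω (r : Set.Iic s) => X r ω := measurable_pi_lambda _ fun r => hX r
    have hC' := hXs hD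
    have hind : ∀ g : Ω → ℝ≥0∞,
        ∫⁻ ω, D.indicator 1 (fun r : Set.Iic s => X r ω) * g ω ∂P =
          ∫⁻ ω in (fun ω (r : Set.Iic s) => X r ω) ⁻¹' D, g ω ∂P := fun g => by
      rw [← lintegral_indicator hC']
      refine lintegral_congr fun ω => ?_
      by_cases hω : (fun r : Set.Iic s => X r ω) ∈ D
      · rw [Set.indicator_of_mem hω, Pi.one_apply, one_mul]
        exact (Set.indicator_of_mem (s := (fun ω (r : Set.Iic s) => X r ω) ⁻¹' D) hω g).symm
      · rw [Set.indicator_of_notMem hω, zero_mul]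
        exact (Set.indicator_of_notMem (s := (fun ω (r : Set.Iic s) => X r ω) ⁻¹' D) hω g).symm
    have key := h s t D hD A hA
    simp_rw [hind, lintegral_indicator_one hA] at key
    have hl : ∫⁻ ω in (fun ω (r : Set.Iic s) => X r ω) ⁻¹' D, A.indicator 1 (X (s + t) ω) ∂P =
        P.restrict ((fun ω (r : Set.Iic s) => X r ω) ⁻¹' D) (X (s + t) ⁻¹' A) :=
      lintegral_indicator_one hA'
    rw [integral_indicator_const _ hA', smul_eq_mul, mul_one, measureReal_def, ← hl, key]
    exact integral_toReal ((κ t).measurable_coe hA |>.comp (hX s)).aemeasurable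
      (ae_of_all _ fun ω => measure_lt_top _ _)

theorem TendstoInTotalVariation.map {E F : Type*} [MeasurableSpace E] [MeasurableSpace F]
    {ν : ℝ≥0 → Measure E} {π : Measure E} (h : TendstoInTotalVariation ν π) {g : E → F}
    (hg : Measurable g) : TendstoInTotalVariation (fun t => (ν t).map g) (π.map g) := by
  unfold TendstoInTotalVariation at h ⊢
  rw [Metric.tendstoUniformlyOn_iff] at h ⊢
  intro ε hε
  filter_upwards [h ε hε] with t ht A hA
  rw [map_measureReal_apply hg hA, map_measureReal_apply hg hA]
  exact ht _ (hg hA)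

end Markov

/-! ### Laws of the centred process and the main theorem. -/

section Conclusion

variable {N : ℕ} {Ω : Type*} [MeasurableSpace Ω] {P : Measure Ω} [IsProbabilityMeasure P]
  {σ δ : ℝ} {B : ℝ≥0 → Ω → Fin N → ℝ} {τ : ℕ → Ω → ℝ≥0} {q : ℕ → Ω → Fin N × Fin N}
  {x : ℝ≥0 → Ω → Fin N → ℝ}

theorem IsSynchronizedSystem.isMarkovProcess_fromCenter
    (h : IsSynchronizedSystem σ δ B τ q x P) (hN : 2 ≤ N) (hδ : 0 < δ) :
    IsMarkovProcess (fun t ω => fromCenter (x t ω)) (centeredTransition N σ δ) P :=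
  .of_lintegral (isTransitionFunction_centeredTransition hN σ hδ).markov
    (fun t => measurable_fromCenter.comp (h.measurable t))
    fun s t _ hD _ hA => h.lintegral_add hN hδ s t hD (measurable_one.indicator hA)

/-- The Markov identity at `s = 0` with trivial past. -/
theorem IsSynchronizedSystem.map_fromCenter (h : IsSynchronizedSystem σ δ B τ q x P) (hN : 2 ≤ N)
    (hδ : 0 < δ) (t : ℝ≥0) : P.map (fun ω => fromCenter (x t ω)) =
      (P.map fun ω => fromCenter (x 0 ω)).bind (centeredTransition N σ δ t) := by
  have hm : ∀ t, Measurable fun ω => fromCenter (x t ω) := fun t =>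
    measurable_fromCenter.comp (h.measurable t)
  ext A hA
  have key := h.lintegral_add hN hδ 0 t MeasurableSet.univ
    (measurable_one.indicator hA : Measurable (A.indicator (1 : CenteredConfig N → ℝ≥0∞)))
  simp only [Set.indicator_univ, Pi.one_apply, one_mul, zero_add, lintegral_indicator_one hA] at key
  rw [Measure.bind_apply hA (Kernel.aemeasurable _), lintegral_map (Kernel.measurable_coe _ hA)
    (hm 0), ← key, Measure.map_apply (hm t) hA]
  exact (lintegral_indicator_one (hm t hA)).symm

end Conclusion

theorem theorem2 (N : ℕ) (hN : 2 ≤ N) (σ δ : ℝ) (hσ : 0 < σ) (hδ : 0 < δ) :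
    ∃ (κ : ℝ≥0 → Kernel (CenteredConfig N) (CenteredConfig N)) (π : Measure (CenteredConfig N))
      (μ : Measure (Fin N → ℝ)),
      IsTransitionFunction κ ∧ SatisfiesDoeblin κ ∧ IsErgodicWith κ π ∧
      IsProbabilityMeasure μ ∧ μ = π.map Subtype.val ∧
      ∀ (Ω : Type*) [MeasurableSpace Ω] (P : Measure Ω) [IsProbabilityMeasure P]
        (B : ℝ≥0 → Ω → Fin N → ℝ) (τ : ℕ → Ω → ℝ≥0) (q : ℕ → Ω → Fin N × Fin N)
        (x : ℝ≥0 → Ω → Fin N → ℝ), IsSynchronizedSystem σ δ B τ q x P →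
        IsMarkovProcess (fun t ω => fromCenter (x t ω)) κ P ∧
        TendstoInTotalVariation
          (fun t => P.map (fun ω i => x t ω i - centerOfMass (x t ω))) μ := by
  have hT := isTransitionFunction_centeredTransition hN σ hδ
  have hD := satisfiesDoeblin_centeredTransition hN σ hδ
  have : Nonempty (CenteredConfig N) := ⟨fromCenter 0⟩
  obtain ⟨π, hπ, hconv⟩ := hD.exists_isErgodicWith hT
  have := hπ.isProbabilityMeasure
  refine ⟨centeredTransition N σ δ, π, π.map Subtype.val, hT, hD, hπ,
    Measure.isProbabilityMeasure_map measurable_subtype_coe.aemeasurable, rfl, ?_⟩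
  intro Ω _ P _ B τ q x h
  refine ⟨h.isMarkovProcess_fromCenter hN hδ, ?_⟩
  have hm : ∀ t, Measurable fun ω => fromCenter (x t ω) := fun t =>
    measurable_fromCenter.comp (h.measurable t)
  have hp := Measure.isProbabilityMeasure_map (μ := P) (hm 0).aemeasurable
  -- Convergence from an arbitrary initial law, pushed forward from the hyperplane to the full
  -- space.
  have htv := (hconv _ hp).map measurable_subtype_coe
  simp_rw [← h.map_fromCenter hN hδ, Measure.map_map measurable_subtype_coe (hm _)] at htv
  exact htv
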